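/- Let $d\ge 1$, let $|\cdot|$ be the Euclidean norm and $\mathcal N=\{z\in\mathbb Z^d:|z|=1\}$. A directed cycle based at $0$ is a finite sequence $\gamma=(v_0,\dots,v_n)$ in $\mathbb Z^d$ with $v_0=v_n=0$, $|v_j-v_{j-1}|=1$ for $1\le j\le n$, and $v_0,\dots,v_{n-1}$ mutually distinct; its oriented edges are $(v_{j-1},v_j)$, and $z+\gamma$ is its translate by $z$. Let $\Gamma_0$ be a set of such cycles with $\{x:\exists\gamma\in\Gamma_0,\ (0,x)\in\gamma\text{ or }(x,0)\in\gamma\}=\mathcal N$. Let $\Omega=[0,\infty)^{\Gamma_0\times\mathbb Z^d}$ with the product (Borel) $\sigma$-algebra $\mathcal F$, let $(\tau_x\omega)_\gamma(y)=\omega_\gamma(x+y)$, and let $\mathbb P$ be a probability measure on $(\Omega,\mathcal F)$ with expectation $\mathbb E$. For $\omega\in\Omega$ put $$c^\omega(x,y)=\sum_{\gamma\in\Gamma_0}\sum_{z\in\mathbb Z^d}\omega_\gamma(z)\mathbf 1_{(x,y)\in z+\gamma}\in[0,\infty],\qquad c^\omega_s(x,y)=\tfrac12\bigl(c^\omega(x,y)+c^\omega(y,x)\bigr),$$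 $$\mu^\omega(x)=\sum_{z\in\mathcal N}c^\omega_s(x,x+z),\qquad \nu^\omega(x)=\sum_{z\in\mathcal N}\frac1{c_s^\omega(x,x+z)}\quad(1/0=\infty).$$ Assume: (a) $\mathbb P\circ\tau_x^{-1}=\mathbb P$ for all $x\in\mathbb Z^d$, and $\mathbb P[A]\in\{0,1\}$ for every $A\in\mathcal F$ with $\tau_x^{-1}(A)=A$ for all $x\in\mathbb Z^d$; (b) for $\mathbb P$-a.e. $\omega$, $\sum_{y}c^\omega(x,y)=\sum_{y}c^\omega(y,x)$ for all $x\in\mathbb Z^d$; (c) $\mathbb P[\nu^\omega(0)<\infty]=1$ and $\mathbb E[\mu^\omega(0)]<\infty$. For $\omega\in\Omega$ and $x\in\mathbb Z^d$ let $P^\omega_x$ be the law of the continuous-time Markov chain $X$ on $\mathbb Z^d$ started at $x$ which waits at its current position $u$ an exponential time with mean $1/\mu^\omega(u)$ and then jumps to $y$ with probability $c^\omega(u,y)/\mu^\omega(u)$. It is built from its jump chain $(Y_n)$ and, independently, i.i.d. mean-one exponential variables $e_n$: the $n$-th jump time is $J_n=\sum_{k<n}e_k/\mu^\omega(Y_k)$,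 and $X_t=Y_n$ for $J_n\le t<J_{n+1}$. Then the following hold. 1. (Non-explosion.) For $\mathbb P$-a.e. $\omega$ and every $x\in\mathbb Z^d$, $P^\omega_x$-almost surely: $\lim_n J_n=\infty$, so that $X_t$ and $\tau_{X_t}\omega$ are defined for all $t\ge0$, and both paths $t\mapsto X_t$ and $t\mapsto\tau_{X_t}\omega$ have only finitely many jumps in every bounded time interval. 2. (Stationarity.) $\mathbb P$ is stationary for the environment process $(\tau_{X_t}\omega)_{t\ge0}$: $\int P^\omega_0[\tau_{X_t}\omega\in A]\,\mathbb P(d\omega)=\mathbb P[A]$ for all $t\ge0$ and $A\in\mathcal F$; moreover the law $Q$ on $\Omega^{[0,\infty)}$ (product $\sigma$-algebra) of $(\tau_{X_t}\omega)_{t\ge0}$ under $\mathbb P(d\omega)\,P_0^\omega$ is invariant under the time shifts $(\theta_sp)(t)=p(s+t)$, $s\ge0$. 3. (Ergodicity.) $\mathbb P$ is ergodic for the environment process: if $A\in\mathcal F$ satisfies $P_0^\omega[\tau_{X_t}\omega\in A]=\mathbf 1_A(\omega)$ for $\mathbb P$-a.e. $\omega$, for every $t\ge0$, then $\mathbb P[A]\in\{0,1\}$;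 and if $B\subseteq\Omega^{[0,\infty)}$ is measurable and $Q(B\,\triangle\,\theta_s^{-1}B)=0$ for every $s\ge0$, then $Q(B)\in\{0,1\}$. -/

import Mathlib

open MeasureTheory ProbabilityTheory Filter Topology
open scoped ENNReal NNReal

noncomputable section

namespace CyclicWalk

/-- The vertex set `ℤ^d`. -/
abbrev Vertex (d : ℕ) : Type := Fin d → ℤ

/-- The set of unit vectors of `ℤ^d` (Euclidean norm one). -/
def unitVectors (d : ℕ) : Set (Vertex d) := {z | ∑ i, z i ^ 2 = 1}

/-- A finite directed nearest-neighbour cycle `(v 0, …, v len)` on `ℤ^d` based at the origin: it starts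
and ends at `0`, consecutive vertices are at distance one, and the vertices are mutually distinct
except that the first and the last one coincide. -/
@[ext]
structure DirectedCycle (d : ℕ) where
  len : ℕ
  vert : Fin (len + 1) → Vertex d
  start_eq : vert 0 = 0
  end_eq : vert (Fin.last len) = 0
  step_mem : ∀ j : Fin len, vert j.succ - vert j.castSucc ∈ unitVectors d
  vert_inj : Function.Injective fun j : Fin len => vert j.castSucc

instance (d : ℕ) : Countable (DirectedCycle d) := by
  let f : DirectedCycle d → Σ n : ℕ, (Fin (n + 1) → Vertex d) := fun γ => ⟨γ.len, γ.vert⟩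
  have hf : Function.Injective f := by
    intro γ γ' h
    simp only [f, Sigma.mk.injEq] at h
    exact DirectedCycle.ext h.1 h.2
  exact hf.countable

/-- The oriented edge `(x, y)` belongs to the cycle `z + γ`. -/
def DirectedCycle.HasEdge {d : ℕ} (γ : DirectedCycle d) (z x y : Vertex d) : Prop :=
  ∃ j : Fin γ.len, z + γ.vert j.castSucc = x ∧ z + γ.vert j.succ = y

/-- The edges at the origin of the cycles in `Γ` cover exactly the unit vectors. -/
def CoversNeighbours {d : ℕ} (Γ : Set (DirectedCycle d)) : Prop :=
  {x : Vertex d | ∃ γ ∈ Γ, γ.HasEdge 0 0 x ∨ γ.HasEdge 0 x 0} = unitVectors d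

/-- Environments: a weight in `[0, ∞)` for every translate `x + γ` of a cycle `γ ∈ Γ`. It carries the
product `σ`-algebra, which is the Borel one because `Γ × ℤ^d` is countable. -/
abbrev Env {d : ℕ} (Γ : Set (DirectedCycle d)) : Type := Γ × Vertex d → ℝ≥0

variable {d : ℕ} {Γ : Set (DirectedCycle d)}

/-- The space shift, `(τ_x ω)_γ(y) = ω_γ(x + y)`. -/
def shift (x : Vertex d) (ω : Env Γ) : Env Γ := fun p => ω (p.1, x + p.2)

/-- `P` is stationary and ergodic with respect to the space shifts. -/
structure IsShiftErgodic (P : Measure (Env Γ)) : Prop where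
  map_shift : ∀ x : Vertex d, P.map (shift x) = P
  zero_or_one : ∀ A : Set (Env Γ), MeasurableSet A →
    (∀ x : Vertex d, shift x ⁻¹' A = A) → P A = 0 ∨ P A = 1

open scoped Classical in
/-- The edge weights `c^ω(x, y)`. -/
def edgeWeight (ω : Env Γ) (x y : Vertex d) : ℝ≥0∞ :=
  ∑' γ : Γ, ∑' z : Vertex d, if γ.1.HasEdge z x y then (ω (γ, z) : ℝ≥0∞) else 0

/-- The symmetric part `c_s^ω(x, y)` of the edge weights. -/
def symWeight (ω : Env Γ) (x y : Vertex d) : ℝ≥0∞ :=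
  (edgeWeight ω x y + edgeWeight ω y x) / 2

/-- The measure `μ^ω(x) = ∑_{|z| = 1} c_s^ω(x, x + z)`. -/
def muWeight (ω : Env Γ) (x : Vertex d) : ℝ≥0∞ :=
  ∑' z : unitVectors d, symWeight ω x (x + z)

/-- The measure `ν^ω(x) = ∑_{|z| = 1} 1 / c_s^ω(x, x + z)`, with `1 / 0 = ∞`. -/
def nuWeight (ω : Env Γ) (x : Vertex d) : ℝ≥0∞ :=
  ∑' z : unitVectors d, (symWeight ω x (x + z))⁻¹

/-- The weights `c^ω` are doubly stochastic. -/
def IsDoublyStochastic (ω : Env Γ) : Prop :=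
  ∀ x : Vertex d, ∑' y, edgeWeight ω x y = ∑' y, edgeWeight ω y x

/-! ### Measurability of the coefficients -/

lemma measurable_shift (x : Vertex d) : Measurable (shift x : Env Γ → Env Γ) := by
  unfold shift; fun_prop

lemma measurable_edgeWeight (x y : Vertex d) :
    Measurable fun ω : Env Γ => edgeWeight ω x y := by
  unfold edgeWeight
  refine Measurable.tsum fun γ => Measurable.tsum fun z => ?_
  split_ifs <;> fun_prop

lemma measurable_muWeight (x : Vertex d) : Measurable fun ω : Env Γ => muWeight ω x := by
  unfold muWeight symWeight
  refine Measurable.tsum fun z => ?_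
  exact ((measurable_edgeWeight _ _).add (measurable_edgeWeight _ _)).div_const _

lemma measurable_muWeight' : Measurable fun p : Env Γ × Vertex d => muWeight p.1 p.2 :=
  measurable_from_prod_countable_left fun x => measurable_muWeight x

/-! ### The jump chain and the holding times -/

/-- The probability `c^ω(x, y) / μ^ω(x)` of jumping from `x` to `y`. -/
def jumpProb (ω : Env Γ) (x y : Vertex d) : ℝ≥0∞ := edgeWeight ω x y / muWeight ω x

open scoped Classical in
/-- The law of the position after a jump from `x`. Only where the numbers `c^ω(x, y) / μ^ω(x)` do not
sum to one (for instance if `μ^ω(x)` is `0` or `∞`) it is replaced by the point mass at `x`. -/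
def jumpMeasure (ω : Env Γ) (x : Vertex d) : Measure (Vertex d) :=
  if ∑' y, jumpProb ω x y = 1 then Measure.sum fun y => jumpProb ω x y • Measure.dirac y
  else Measure.dirac x

instance (ω : Env Γ) (x : Vertex d) : IsProbabilityMeasure (jumpMeasure ω x) := by
  unfold jumpMeasure
  split_ifs with h
  · constructor
    simpa [Measure.sum_apply] using h
  · infer_instance

lemma measurable_jumpProb (x y : Vertex d) : Measurable fun ω : Env Γ => jumpProb ω x y :=
  (measurable_edgeWeight x y).div (measurable_muWeight x)

lemma measurable_jumpMeasure :
    Measurable fun p : Env Γ × Vertex d => jumpMeasure p.1 p.2 := by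
  refine measurable_from_prod_countable_left fun x => ?_
  unfold jumpMeasure
  refine Measurable.ite ?_ ?_ (measurable_const (a := Measure.dirac x))
  · exact (Measurable.tsum fun y => measurable_jumpProb x y) (measurableSet_singleton 1)
  · refine Measure.measurable_of_measurable_coe _ fun s hs => ?_
    simp only [Measure.sum_apply _ hs, Measure.smul_apply, smul_eq_mul]
    exact Measurable.tsum fun y => (measurable_jumpProb x y).mul_const _

/-- The jump measures as a Markov kernel from `(ω, x)` to the next position. -/
def jumpKernel (Γ : Set (DirectedCycle d)) : Kernel (Env Γ × Vertex d) (Vertex d) where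
  toFun p := jumpMeasure p.1 p.2
  measurable' := measurable_jumpMeasure

instance : IsMarkovKernel (jumpKernel Γ) :=
  ⟨fun p => inferInstanceAs (IsProbabilityMeasure (jumpMeasure p.1 p.2))⟩

/-- One step of the jump chain, with the environment carried along as a constant coordinate. -/
def stepKernel (Γ : Set (DirectedCycle d)) :
    Kernel (Env Γ × Vertex d) (Env Γ × Vertex d) :=
  Kernel.prod (Kernel.deterministic Prod.fst measurable_fst) (jumpKernel Γ)

instance : IsMarkovKernel (stepKernel Γ) := by unfold stepKernel; infer_instance

/-- The step kernel in the form used by the Ionescu-Tulcea theorem. -/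
def histKernel (Γ : Set (DirectedCycle d)) (n : ℕ) :
    Kernel (Π _ : Finset.Iic n, Env Γ × Vertex d) (Env Γ × Vertex d) :=
  (stepKernel Γ).comap (fun h => h ⟨n, Finset.mem_Iic.2 le_rfl⟩) (measurable_pi_apply _)

instance (n : ℕ) : IsMarkovKernel (histKernel Γ n) := by unfold histKernel; infer_instance

/-- The law, given `(ω, x)`, of the jump chain `(Y_n)` in the environment `ω` started at `x`. -/
def chainKernel (Γ : Set (DirectedCycle d)) : Kernel (Env Γ × Vertex d) (ℕ → Vertex d) :=
  ((Kernel.traj (X := fun _ => Env Γ × Vertex d) (histKernel Γ) 0).comap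
    (fun p _ => p) (measurable_pi_lambda _ fun _ => measurable_id)).map
      (fun ξ n => (ξ n).2)

instance : IsProbabilityMeasure (expMeasure 1) := isProbabilityMeasure_expMeasure one_pos

/-- The randomness of the walk: the successive positions `Y_n`, and the clocks `e_n`. -/
abbrev Traj (d : ℕ) : Type := (ℕ → Vertex d) × (ℕ → ℝ)

/-- The quenched law `P_x^ω`, as a kernel in `(ω, x)`: the jump chain, and independently of it
independent exponential clocks with mean one. -/
def quenchedLaw (Γ : Set (DirectedCycle d)) : Kernel (Env Γ × Vertex d) (Traj d) :=
  Kernel.prod (chainKernel Γ) (Kernel.const _ (Measure.infinitePi fun _ : ℕ => expMeasure 1))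

instance : IsMarkovKernel (quenchedLaw Γ) := by
  have : IsMarkovKernel (chainKernel Γ) := by
    unfold chainKernel
    exact Kernel.IsMarkovKernel.map _
      (measurable_pi_lambda _ fun n => measurable_snd.comp (measurable_pi_apply n))
  unfold quenchedLaw; infer_instance

/-- The `n`-th holding time `e_n / μ^ω(Y_n)`: given the jump chain, exponential with mean
`1 / μ^ω(Y_n)` (and infinite if `μ^ω(Y_n) = 0`). -/
def holdingTime (ω : Env Γ) (ξ : Traj d) (n : ℕ) : ℝ≥0∞ :=
  ENNReal.ofReal (ξ.2 n) / muWeight ω (ξ.1 n)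

/-- The time of the `n`-th jump; the zeroth one is `0`. -/
def jumpTime (ω : Env Γ) (ξ : Traj d) (n : ℕ) : ℝ≥0∞ :=
  ∑ k ∈ Finset.range n, holdingTime ω ξ k

/-- The explosion time, the limit of the jump times. -/
def explosionTime (ω : Env Γ) (ξ : Traj d) : ℝ≥0∞ := ⨆ n, jumpTime ω ξ n

open scoped Classical in
/-- The walk `X_t`: it equals `Y_n` for `t` between the `n`-th and the `(n+1)`-st jump time. From the
explosion time on (if that is finite) it is given the conventional value `Y_0`. -/
def walk (ω : Env Γ) (ξ : Traj d) (t : ℝ≥0) : Vertex d :=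
  if h : ∃ n, (t : ℝ≥0∞) < jumpTime ω ξ (n + 1) then ξ.1 (Nat.find h) else ξ.1 0

/-- The environment seen from the walker, `τ_{X_t} ω`. -/
def envProcess (ω : Env Γ) (ξ : Traj d) (t : ℝ≥0) : Env Γ := shift (walk ω ξ t) ω

/-- A path has only finitely many jumps (times where it is not locally constant) in every bounded
time interval. -/
def HasFinitelyManyJumps {α : Type*} (p : ℝ≥0 → α) : Prop :=
  ∀ T : ℝ≥0, {t : ℝ≥0 | t ≤ T ∧ ¬ ∀ᶠ s in 𝓝 t, p s = p t}.Finite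

/-! ### The environment process started from `P` -/

/-- The transition probabilities `P_0^ω(τ_{X_t} ω ∈ A)` of the environment process. -/
def envTransition (t : ℝ≥0) (ω : Env Γ) (A : Set (Env Γ)) : ℝ≥0∞ :=
  quenchedLaw Γ (ω, 0) {ξ | envProcess ω ξ t ∈ A}

/-- The joint law of the environment, distributed according to `P`, and of the walk started at the
origin in it. -/
def annealedLaw (P : Measure (Env Γ)) : Measure (Env Γ × Traj d) :=
  P ⊗ₘ ((quenchedLaw Γ).comap (fun ω => (ω, 0)) (by fun_prop))

/-- The law of the process `(τ_{X_t} ω)_{t ≥ 0}` with initial law `P`, on the space of all paths with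
the product `σ`-algebra. -/
def envPathLaw (P : Measure (Env Γ)) : Measure (ℝ≥0 → Env Γ) :=
  (annealedLaw P).map fun q t => envProcess q.1 q.2 t

/-- The time shift on paths. -/
def timeShift {α : Type*} (s : ℝ≥0) (p : ℝ≥0 → α) : ℝ≥0 → α := fun t => p (s + t)

/-- `P` is stationary for the environment process: it is invariant under the transition
probabilities, and the process with initial law `P` has a law invariant under time shifts. -/
structure IsStationaryForEnvProcess (P : Measure (Env Γ)) : Prop where
  invariant : ∀ (t : ℝ≥0) (A : Set (Env Γ)), MeasurableSet A →
    ∫⁻ ω, envTransition t ω A ∂P = P A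
  map_timeShift : ∀ s : ℝ≥0, (envPathLaw P).map (timeShift s) = envPathLaw P

/-- `P` is ergodic for the environment process: every set of environments that is invariant under the
transition probabilities, and every event on path space that is invariant under all time shifts, both
up to null sets, has probability zero or one. -/
structure IsErgodicForEnvProcess (P : Measure (Env Γ)) : Prop where
  zero_or_one_of_invariant : ∀ A : Set (Env Γ), MeasurableSet A →
    (∀ t : ℝ≥0, ∀ᵐ ω ∂P, envTransition t ω A = A.indicator 1 ω) → P A = 0 ∨ P A = 1
  zero_or_one_of_timeShift : ∀ B : Set (ℝ≥0 → Env Γ), MeasurableSet B →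
    (∀ s : ℝ≥0, timeShift s ⁻¹' B =ᵐ[envPathLaw P] B) →
      envPathLaw P B = 0 ∨ envPathLaw P B = 1

/-! ### Measurability of the environment process -/

lemma measurable_jumpTime (n : ℕ) :
    Measurable fun q : Env Γ × Traj d => jumpTime q.1 q.2 n := by
  unfold jumpTime holdingTime
  refine Finset.measurable_sum _ fun k _ => ?_
  refine Measurable.div (by fun_prop) ?_
  exact measurable_muWeight'.comp (by fun_prop : Measurable fun q : Env Γ × Traj d =>
    (q.1, q.2.1 k))

lemma measurable_walk (t : ℝ≥0) : Measurable fun q : Env Γ × Traj d => walk q.1 q.2 t := by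
  classical
  have hS : ∀ n, MeasurableSet {q : Env Γ × Traj d | (t : ℝ≥0∞) < jumpTime q.1 q.2 (n + 1)} :=
    fun n => measurableSet_lt measurable_const (measurable_jumpTime (n + 1))
  have hY : ∀ n, Measurable fun q : Env Γ × Traj d => q.2.1 n := fun n => by fun_prop
  refine measurable_to_countable' fun x => ?_
  have : (fun q : Env Γ × Traj d => walk q.1 q.2 t) ⁻¹' {x} =
      (⋃ n, ({q | (t : ℝ≥0∞) < jumpTime q.1 q.2 (n + 1)} ∩
        (⋂ m ∈ Finset.range n, {q | (t : ℝ≥0∞) < jumpTime q.1 q.2 (m + 1)}ᶜ) ∩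
          {q | q.2.1 n = x})) ∪
      ((⋂ n, {q | (t : ℝ≥0∞) < jumpTime q.1 q.2 (n + 1)}ᶜ) ∩ {q | q.2.1 0 = x}) := by
    ext q
    simp only [Set.mem_preimage, Set.mem_singleton_iff, Set.mem_union, Set.mem_iUnion,
      Set.mem_inter_iff, Set.mem_iInter, Set.mem_compl_iff, Set.mem_ofPred_eq, Finset.mem_range]
    unfold walk
    split_ifs with h
    · constructor
      · intro hx
        exact Or.inl ⟨Nat.find h, ⟨Nat.find_spec h, fun m hm => Nat.find_min h hm⟩, hx⟩
      · rintro (⟨n, ⟨h1, h2⟩, h3⟩ | ⟨h1, _⟩)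
        · have : Nat.find h = n := (Nat.find_eq_iff h).2 ⟨h1, h2⟩
          rw [this, h3]
        · exact absurd h (not_exists.2 h1)
    · constructor
      · intro hx
        exact Or.inr ⟨not_exists.1 h, hx⟩
      · rintro (⟨n, ⟨h1, _⟩, _⟩ | ⟨_, h2⟩)
        · exact absurd ⟨n, h1⟩ h
        · exact h2
  rw [this]
  have hx : ∀ n, MeasurableSet {q : Env Γ × Traj d | q.2.1 n = x} :=
    fun n => hY n (measurableSet_singleton x)
  refine MeasurableSet.union (MeasurableSet.iUnion fun n => ((hS n).inter ?_).inter (hx n))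
    ((MeasurableSet.iInter fun n => (hS n).compl).inter (hx 0))
  exact Finset.measurableSet_biInter _ fun m _ => (hS m).compl

/-- The path map defining `envPathLaw` is measurable, so that this is a genuine image measure. -/
lemma measurable_envProcess :
    Measurable fun (q : Env Γ × Traj d) (t : ℝ≥0) => envProcess q.1 q.2 t := by
  refine measurable_pi_lambda _ fun t => ?_
  have h : Measurable fun p : Env Γ × Vertex d => shift p.2 p.1 :=
    measurable_from_prod_countable_left fun x => measurable_shift x
  exact h.comp (measurable_fst.prodMk (measurable_walk t))

end CyclicWalk

end

noncomputable section

namespace CyclicWalk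

variable {d : ℕ} {Γ : Set (DirectedCycle d)}

/-! ### Shifts and coefficients -/

/-! Weight `P` by the total rate `μ^ω(0)`. Double stochasticity says that inflow equals outflow at
every vertex. Together with shift stationarity this makes the weighted measure invariant for the
environment seen from the jump chain (`lintegral_muWeight_jump`). By the Markov property, restarting
a trajectory at its first jump then preserves the finite measure `palmLaw P`
(`measurePreserving_restart_one`). As `0 < μ^ω(0)` almost surely, `palmLaw P` and `annealedLaw P`
have the same null sets.

Non-explosion is Poincaré recurrence: a first holding time exceeding `1/k` is matched by infinitely
many later ones exceeding `1/k`, so their sum diverges (`ae_annealedLaw_explosion`).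

For stationarity the process is viewed as a flow built over `restart 1` with the holding time as
roof. Memorylessness of the first clock shows that the law started from `P` is the `palmLaw
P`-integral of the path observed throughout its first sojourn (`lintegral_annealedLaw_envPath`).
Shifting by `s` changes this sojourn integral by a coboundary of `restart 1`, whose integral
vanishes (`map_timeShift_envPathLaw`).

For ergodicity, finiteness of `ν^ω` makes every nearest-neighbour edge usable in at least one
direction, so a set of environments preserved by all possible jumps is almost surely preserved by
all shifts (`IsShiftErgodic.zero_or_one_of_jump`). For a set invariant under the transition
probabilities, one jump before time one suffices. A shift-invariant path event is first shown to be
invariant under restarting (`restart_preimage_ae_eq`). Approximating it by events determined before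
the `n`-th jump gives it quenched probability zero or one (`quenchedProb_zero_or_one`). This
probability is harmonic for the jumps, so the environments where it equals one form a set preserved
by jumps. -/

lemma shift_shift (x y : Vertex d) (ω : Env Γ) : shift x (shift y ω) = shift (y + x) ω := by
  ext p; simp [shift, add_assoc]

@[simp] lemma shift_zero (ω : Env Γ) : shift 0 ω = ω := by
  ext p; simp [shift]

lemma measurable_shift_uncurry : Measurable fun p : Env Γ × Vertex d => shift p.2 p.1 :=
  measurable_from_prod_countable_left fun x => measurable_shift x

lemma neg_mem_unitVectors {z : Vertex d} : -z ∈ unitVectors d ↔ z ∈ unitVectors d := by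
  simp [unitVectors]

lemma single_mem_unitVectors (i : Fin d) : Pi.single i (1 : ℤ) ∈ unitVectors d := by
  simp only [unitVectors, Set.mem_ofPred_eq]
  rw [Finset.sum_eq_single i] <;> simp +contextual

lemma unitVectors_nonempty (hd : 1 ≤ d) : (unitVectors d).Nonempty :=
  ⟨_, single_mem_unitVectors ⟨0, hd⟩⟩

lemma hasEdge_add_left (γ : DirectedCycle d) (w z x y : Vertex d) :
    γ.HasEdge (w + z) (w + x) (w + y) ↔ γ.HasEdge z x y := by
  simp [DirectedCycle.HasEdge, add_assoc]

open scoped Classical in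
lemma edgeWeight_shift (w : Vertex d) (ω : Env Γ) (x y : Vertex d) :
    edgeWeight (shift w ω) x y = edgeWeight ω (w + x) (w + y) := by
  unfold edgeWeight
  refine tsum_congr fun γ => ?_
  rw [← (Equiv.addLeft w).tsum_eq (fun z => if γ.1.HasEdge z (w + x) (w + y) then
    (ω (γ, z) : ℝ≥0∞) else 0)]
  refine tsum_congr fun z => ?_
  simp only [Equiv.coe_addLeft, hasEdge_add_left, shift]

lemma symWeight_shift (w : Vertex d) (ω : Env Γ) (x y : Vertex d) :
    symWeight (shift w ω) x y = symWeight ω (w + x) (w + y) := by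
  simp [symWeight, edgeWeight_shift]

lemma muWeight_shift (w : Vertex d) (ω : Env Γ) (x : Vertex d) :
    muWeight (shift w ω) x = muWeight ω (w + x) := by
  simp [muWeight, symWeight_shift, add_assoc]

lemma nuWeight_shift (w : Vertex d) (ω : Env Γ) (x : Vertex d) :
    nuWeight (shift w ω) x = nuWeight ω (w + x) := by
  simp [nuWeight, symWeight_shift, add_assoc]

lemma jumpProb_shift (w : Vertex d) (ω : Env Γ) (x y : Vertex d) :
    jumpProb (shift w ω) x y = jumpProb ω (w + x) (w + y) := by
  simp [jumpProb, edgeWeight_shift, muWeight_shift]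

lemma jumpMeasure_singleton (ω : Env Γ) (x y : Vertex d)
    (h : ∑' y, jumpProb ω x y = 1) : jumpMeasure ω x {y} = jumpProb ω x y := by
  rw [jumpMeasure, if_pos h, Measure.sum_apply _ (measurableSet_singleton y),
    tsum_eq_single y fun z hz => by simp [hz]]
  simp

lemma jumpMeasure_shift (w : Vertex d) (ω : Env Γ) (x y : Vertex d) :
    jumpMeasure (shift w ω) x {y} = jumpMeasure ω (w + x) {w + y} := by
  have h : ∑' y, jumpProb (shift w ω) x y = ∑' y, jumpProb ω (w + x) y := by
    simp only [jumpProb_shift]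
    exact (Equiv.addLeft w).tsum_eq (fun z => jumpProb ω (w + x) z)
  by_cases h1 : ∑' y, jumpProb ω (w + x) y = 1
  · rw [jumpMeasure_singleton _ _ _ (h.trans h1), jumpMeasure_singleton _ _ _ h1, jumpProb_shift]
  -- The fallback point mass is translation covariant as well, so no regularity of `ω` is needed
  -- here or in `chainKernel_shift`.
  · rw [jumpMeasure, jumpMeasure, if_neg h1, if_neg (by rwa [h])]
    simp [Measure.dirac_apply', Set.indicator_apply]

lemma edgeWeight_eq_zero (ω : Env Γ) {x y : Vertex d} (h : y - x ∉ unitVectors d) :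
    edgeWeight ω x y = 0 := by
  simp only [edgeWeight, ENNReal.tsum_eq_zero, ite_eq_right_iff]
  rintro γ z ⟨j, rfl, rfl⟩
  exact absurd (by simpa using γ.1.step_mem j) h

lemma tsum_unitVectors (f : Vertex d → ℝ≥0∞) (x : Vertex d)
    (hf : ∀ y, y - x ∉ unitVectors d → f y = 0) :
    ∑' z : unitVectors d, f (x + z) = ∑' y, f y := by
  rw [← (Equiv.addLeft x).tsum_eq f]
  refine tsum_subtype_eq_of_support_subset (f := fun z => f (x + z)) fun z hz => ?_
  by_contra h
  exact hz (hf _ (by simpa using h))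

/-- Outflow and inflow agree, so symmetrising the weights does not change their total. Hence the
holding rate is exactly the normalisation of the jump probabilities. -/
lemma muWeight_eq_tsum {ω : Env Γ} (h : IsDoublyStochastic ω) (x : Vertex d) :
    muWeight ω x = ∑' y, edgeWeight ω x y := by
  have h1 := tsum_unitVectors (fun y => edgeWeight ω x y) x fun y hy => edgeWeight_eq_zero ω hy
  have h2 := tsum_unitVectors (fun y => edgeWeight ω y x) x fun y hy => edgeWeight_eq_zero ω
    fun h => hy (by simpa using neg_mem_unitVectors.2 h)
  simp only [muWeight, symWeight, div_eq_mul_inv]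
  rw [ENNReal.tsum_mul_right, ENNReal.tsum_add, h1, h2, ← h x, ← two_mul, mul_comm (2 : ℝ≥0∞),
    mul_assoc, ENNReal.mul_inv_cancel (by simp) (by simp), mul_one]

/-- The environments in which the coefficients have all the properties that hold almost surely. -/
structure IsRegular (ω : Env Γ) : Prop where
  doublyStochastic : IsDoublyStochastic ω
  muWeight_ne_zero : ∀ x, muWeight ω x ≠ 0
  muWeight_ne_top : ∀ x, muWeight ω x ≠ ∞
  symWeight_ne_zero : ∀ x, ∀ z ∈ unitVectors d, symWeight ω x (x + z) ≠ 0

lemma IsDoublyStochastic.shift {ω : Env Γ} (h : IsDoublyStochastic ω) (w : Vertex d) :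
    IsDoublyStochastic (shift w ω) := by
  intro x
  simp only [edgeWeight_shift]
  exact ((Equiv.addLeft w).tsum_eq fun y => edgeWeight ω (w + x) y).trans
    ((h _).trans ((Equiv.addLeft w).tsum_eq fun y => edgeWeight ω y (w + x)).symm)

lemma IsRegular.shift {ω : Env Γ} (h : IsRegular ω) (w : Vertex d) :
    IsRegular (shift w ω) where
  doublyStochastic := h.doublyStochastic.shift w
  muWeight_ne_zero x := by rw [muWeight_shift]; exact h.muWeight_ne_zero _
  muWeight_ne_top x := by rw [muWeight_shift]; exact h.muWeight_ne_top _
  symWeight_ne_zero x z hz := by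
    rw [symWeight_shift, ← add_assoc]; exact h.symWeight_ne_zero _ z hz

lemma IsRegular.tsum_jumpProb {ω : Env Γ} (h : IsRegular ω) (x : Vertex d) :
    ∑' y, jumpProb ω x y = 1 := by
  simp only [jumpProb, div_eq_mul_inv]
  rw [ENNReal.tsum_mul_right, ← muWeight_eq_tsum h.doublyStochastic,
    ENNReal.mul_inv_cancel (h.muWeight_ne_zero x) (h.muWeight_ne_top x)]

lemma IsRegular.jumpMeasure_singleton {ω : Env Γ} (h : IsRegular ω) (x y : Vertex d) :
    jumpMeasure ω x {y} = edgeWeight ω x y / muWeight ω x :=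
  CyclicWalk.jumpMeasure_singleton ω x y (h.tsum_jumpProb x)

/-! ### Almost sure regularity, the invariant density, and sets preserved by jumps -/

section Stationary

variable {P : Measure (Env Γ)}

lemma IsShiftErgodic.measurePreserving (h : IsShiftErgodic P) (x : Vertex d) :
    MeasurePreserving (shift x) P P := ⟨measurable_shift x, h.map_shift x⟩

lemma IsShiftErgodic.ae_forall_shift (h : IsShiftErgodic P) {p : Env Γ → Prop}
    (hp : ∀ᵐ ω ∂P, p ω) : ∀ᵐ ω ∂P, ∀ x : Vertex d, p (shift x ω) :=
  ae_all_iff.2 fun x => (h.measurePreserving x).quasiMeasurePreserving.ae hp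

lemma IsShiftErgodic.lintegral_shift (h : IsShiftErgodic P) (x : Vertex d)
    {f : Env Γ → ℝ≥0∞} (hf : Measurable f) : ∫⁻ ω, f (shift x ω) ∂P = ∫⁻ ω, f ω ∂P :=
  (h.measurePreserving x).lintegral_comp hf

/-- A vanishing symmetric weight would contribute `1/0 = ∞` to `ν^ω`. Since `1 ≤ d` there is an edge
at every vertex, so positive edge weights make `μ^ω` positive. -/
lemma ae_isRegular (hd : 1 ≤ d) (hP : IsShiftErgodic P)
    (hdoubly : ∀ᵐ ω ∂P, IsDoublyStochastic ω) (hnu : ∀ᵐ ω ∂P, nuWeight ω 0 < ∞)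
    (hmu : ∫⁻ ω, muWeight ω 0 ∂P < ∞) : ∀ᵐ ω ∂P, IsRegular ω := by
  have hmu' : ∀ᵐ ω ∂P, muWeight ω 0 < ∞ := ae_lt_top (measurable_muWeight 0) hmu.ne
  filter_upwards [hdoubly, hP.ae_forall_shift hnu, hP.ae_forall_shift hmu'] with ω h1 h2 h3
  simp only [nuWeight_shift, muWeight_shift, add_zero] at h2 h3
  have h4 : ∀ x, ∀ z ∈ unitVectors d, symWeight ω x (x + z) ≠ 0 := by
    intro x z hz h0
    have := ENNReal.ne_top_of_tsum_ne_top (h2 x).ne ⟨z, hz⟩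
    simp [h0] at this
  refine ⟨h1, fun x h0 => ?_, fun x => (h3 x).ne, h4⟩
  obtain ⟨z, hz⟩ := unitVectors_nonempty hd
  exact h4 x z hz (ENNReal.tsum_eq_zero.1 h0 ⟨z, hz⟩)

/-- The measure with density `μ^ω(0)` is invariant for the jump chain of the environment. -/
lemma lintegral_muWeight_jump (hP : IsShiftErgodic P) (hreg : ∀ᵐ ω ∂P, IsRegular ω)
    {g : Env Γ → ℝ≥0∞} (hg : Measurable g) :
    ∫⁻ ω, muWeight ω 0 * ∫⁻ y, g (shift y ω) ∂(jumpMeasure ω 0) ∂P =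
      ∫⁻ ω, muWeight ω 0 * g ω ∂P := by
  have hm : ∀ x y : Vertex d, Measurable fun ω : Env Γ => edgeWeight ω x y := measurable_edgeWeight
  calc ∫⁻ ω, muWeight ω 0 * ∫⁻ y, g (shift y ω) ∂(jumpMeasure ω 0) ∂P
      = ∫⁻ ω, ∑' y, edgeWeight ω 0 y * g (shift y ω) ∂P := by
        refine lintegral_congr_ae (hreg.mono fun ω hω => ?_)
        simp only [lintegral_countable', hω.jumpMeasure_singleton, ← ENNReal.tsum_mul_left]
        refine tsum_congr fun y => ?_
        rw [mul_comm (g _), ← mul_assoc, ENNReal.mul_div_cancel (hω.muWeight_ne_zero 0)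
          (hω.muWeight_ne_top 0)]
    _ = ∑' y, ∫⁻ ω, edgeWeight ω 0 y * g (shift y ω) ∂P :=
        lintegral_tsum fun y => ((hm _ _).mul (hg.comp (measurable_shift y))).aemeasurable
    -- Mass transport: by stationarity under the shift by `y`, the flow from `0` to `y` becomes flow
    -- from `-y` into `0`.
    _ = ∑' y, ∫⁻ ω, edgeWeight ω (-y) 0 * g ω ∂P := by
        refine tsum_congr fun y => ?_
        rw [← hP.lintegral_shift y (f := fun ω => edgeWeight ω (-y) 0 * g ω) ((hm _ _).mul hg)]
        simp [edgeWeight_shift]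
    _ = ∫⁻ ω, ∑' y, edgeWeight ω (-y) 0 * g ω ∂P :=
        (lintegral_tsum fun y => ((hm _ _).mul hg).aemeasurable).symm
    _ = ∫⁻ ω, muWeight ω 0 * g ω ∂P := by
        refine lintegral_congr_ae (hreg.mono fun ω hω => ?_)
        simp only
        rw [ENNReal.tsum_mul_right, muWeight_eq_tsum hω.doublyStochastic, hω.doublyStochastic 0]
        exact congrArg (· * g ω) ((Equiv.neg (Vertex d)).tsum_eq fun y => edgeWeight ω y 0)

/-- A set of environments that is compatible with the jumps of the walk has probability zero or
one. -/
lemma IsShiftErgodic.zero_or_one_of_jump (hP : IsShiftErgodic P) (hreg : ∀ᵐ ω ∂P, IsRegular ω)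
    {A : Set (Env Γ)} (hA : MeasurableSet A)
    (h : ∀ᵐ ω ∂P, ∀ z, edgeWeight ω 0 z ≠ 0 → (shift z ω ∈ A ↔ ω ∈ A)) :
    P A = 0 ∨ P A = 1 := by
  have hconst : ∀ᵐ ω ∂P, ∀ x, (shift x ω ∈ A ↔ ω ∈ A) := by
    filter_upwards [hreg, hP.ae_forall_shift h] with ω hω hs
    have hedge : ∀ x y : Vertex d, edgeWeight ω x y ≠ 0 → (shift y ω ∈ A ↔ shift x ω ∈ A) := by
      intro x y hxy
      have := hs x (y - x)
      simp only [edgeWeight_shift, shift_shift, add_zero, add_sub_cancel] at this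
      exact this hxy
    -- A positive symmetric weight gives a usable edge in one of the two directions, and the
    -- equivalence along it can be read both ways.
    have hnb : ∀ x, ∀ z ∈ unitVectors d, (shift (x + z) ω ∈ A ↔ shift x ω ∈ A) := by
      intro x z hz
      have := hω.symWeight_ne_zero x z hz
      by_cases h1 : edgeWeight ω x (x + z) = 0
      · have h2 : edgeWeight ω (x + z) x ≠ 0 := fun h2 => this (by simp [symWeight, h1, h2])
        exact (hedge _ _ h2).symm
      · exact hedge _ _ h1
    -- Quantifying over all base points `x` makes the admissible displacements a group; it contains
    -- the coordinate vectors, hence everything.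
    let H : AddSubgroup (Vertex d) :=
      { carrier := {z | ∀ x, (shift (x + z) ω ∈ A ↔ shift x ω ∈ A)}
        add_mem' := by
          intro a b ha hb x
          rw [← add_assoc, hb, ha]
        zero_mem' := by simp
        neg_mem' := by
          intro a ha x
          have := ha (x + -a)
          simpa using this.symm }
    have hH : ∀ z, z ∈ H := by
      intro z
      have : z = ∑ i, z i • Pi.single i (1 : ℤ) := by
        ext j
        simp [Finset.sum_apply, Pi.single_apply]
      rw [this]
      exact H.sum_mem fun i _ => H.zsmul_mem (fun x => hnb x _ (single_mem_unitVectors i)) _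
    intro x
    simpa using hH x 0
  -- `zero_or_one` requires strict invariance, so `A` is replaced by a strictly invariant set equal
  -- to it almost everywhere.
  let A' : Set (Env Γ) := {ω | ∀ x, shift x ω ∈ A}
  have hA' : MeasurableSet A' := by
    simp only [A', Set.ofPred_forall]
    exact MeasurableSet.iInter fun x => measurable_shift x hA
  have hAA : A' =ᵐ[P] A := by
    refine eventuallyEq_set.2 (hconst.mono fun ω hω => ?_)
    exact ⟨fun h => by simpa using h 0, fun h x => (hω x).2 h⟩
  rw [← measure_congr hAA]
  refine hP.zero_or_one A' hA' fun x => ?_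
  ext ω
  simp only [A', Set.mem_preimage, Set.mem_ofPred_eq, shift_shift]
  exact ⟨fun h y => by simpa using h (-x + y), fun h y => h _⟩

end Stationary

/-! ### Finite-dimensional distributions and the Markov property of the jump chain -/

section Trajectory

variable {X : ℕ → Type*} [∀ n, MeasurableSpace (X n)]
  (κ : (n : ℕ) → Kernel (Π i : Finset.Iic n, X i) (X (n + 1))) [∀ n, IsMarkovKernel (κ n)]

lemma lintegral_traj_frestrictLe_zero (a : Π i : Finset.Iic 0, X i)
    {G : (Π i : Finset.Iic 0, X i) → ℝ≥0∞} (hG : Measurable G) :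
    ∫⁻ ξ, G (Preorder.frestrictLe 0 ξ) ∂Kernel.traj κ 0 a = G a := by
  rw [← lintegral_map (f := G) hG (Preorder.measurable_frestrictLe 0),
    Kernel.traj_map_frestrictLe_apply, Kernel.partialTraj_self, Kernel.id_apply,
    lintegral_dirac' _ hG]

/-- Conditioning on the coordinates up to `n`: given them, the next coordinate has law `κ n`, and
the factor `G` is frozen. -/
lemma lintegral_traj_succ (n : ℕ) (a : Π i : Finset.Iic 0, X i)
    {G : (Π i : Finset.Iic n, X i) → ℝ≥0∞} (hG : Measurable G)
    {g : X (n + 1) → ℝ≥0∞} (hg : Measurable g) :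
    ∫⁻ ξ, G (Preorder.frestrictLe n ξ) * g (ξ (n + 1)) ∂Kernel.traj κ 0 a =
      ∫⁻ ξ, G (Preorder.frestrictLe n ξ) * ∫⁻ z, g z ∂κ n (Preorder.frestrictLe n ξ)
        ∂Kernel.traj κ 0 a := by
  have hm : Measurable fun ξ : Π n, X n => G (Preorder.frestrictLe n ξ) * g (ξ (n + 1)) :=
    (hG.comp (Preorder.measurable_frestrictLe n)).mul (hg.comp (measurable_pi_apply _))
  have hm' : Measurable fun h : Π i : Finset.Iic n, X i => G h * ∫⁻ z, g z ∂κ n h :=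
    hG.mul hg.lintegral_kernel
  rw [← lintegral_map (f := fun h => G h * ∫⁻ z, g z ∂κ n h) hm'
      (Preorder.measurable_frestrictLe n),
    Kernel.traj_map_frestrictLe_apply, ← Kernel.traj_comp_partialTraj (Nat.zero_le n),
    Kernel.lintegral_comp _ _ _ hm]
  refine lintegral_congr fun h => ?_
  rw [Kernel.lintegral_traj _ hm]
  have h1 : ∀ ξ : Π n, X n, Preorder.frestrictLe n (Function.updateFinset ξ (Finset.Iic n) h) = h :=
    fun ξ => by
      ext i
      simp [Function.updateFinset]
  have h2 : ∀ ξ : Π n, X n, Function.updateFinset ξ (Finset.Iic n) h (n + 1) = ξ (n + 1) :=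
    fun ξ => by simp [Function.updateFinset]
  simp only [h1, h2]
  refine (lintegral_const_mul (G h) (hg.comp (measurable_pi_apply _))).trans ?_
  rw [← Kernel.map_traj_succ_self (κ := κ),
    Kernel.map_apply _ (measurable_pi_apply _), lintegral_map hg (measurable_pi_apply _)]
  rfl

end Trajectory

/-- The sequences that agree with `y` up to and including the index `n`. -/
def prefixSet {α : Type*} (n : ℕ) (y : ℕ → α) : Set (ℕ → α) := {Y | ∀ i ≤ n, Y i = y i}

lemma prefixSet_eq_iInter {α : Type*} (n : ℕ) (y : ℕ → α) :
    prefixSet n y = ⋂ i ∈ Finset.range (n + 1), (fun Y : ℕ → α => Y i) ⁻¹' {y i} := by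
  ext Y
  simp [prefixSet]

lemma measurableSet_prefixSet {α : Type*} [MeasurableSpace α] [MeasurableSingletonClass α] (n : ℕ)
    (y : ℕ → α) : MeasurableSet (prefixSet n y) := by
  rw [prefixSet_eq_iInter]
  exact Finset.measurableSet_biInter _ fun i _ =>
    measurable_pi_apply i (measurableSet_singleton _)

/-- Probability measures on the sequences in a countable space are determined by the masses of long
prefixes. -/
lemma ext_of_prefixSet {α : Type*} [MeasurableSpace α] [MeasurableSingletonClass α] [Countable α]
    {μ ν : Measure (ℕ → α)} [IsProbabilityMeasure μ] [IsProbabilityMeasure ν] (N : ℕ)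
    (h : ∀ n ≥ N, ∀ y, μ (prefixSet n y) = ν (prefixSet n y)) : μ = ν := by
  let C : Set (Set (ℕ → α)) := {s | ∃ n ≥ N, ∃ y, s = prefixSet n y}
  have hgen : (MeasurableSpace.pi : MeasurableSpace (ℕ → α)) = MeasurableSpace.generateFrom C := by
    refine le_antisymm ?_ (MeasurableSpace.generateFrom_le ?_)
    · refine iSup_le fun i => ?_
      rw [← measurable_iff_comap_le]
      refine @measurable_to_countable' _ _ _ _ (MeasurableSpace.generateFrom C) _ fun v => ?_
      -- Decomposition according to the countably many words of length `max N i + 1`; beyond the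
      -- word the representative sequence is irrelevant and filled with `v`.
      have hv : (fun Y : ℕ → α => Y i) ⁻¹' {v} =
          ⋃ w : {w : Fin (max N i + 1) → α // w ⟨i, by omega⟩ = v},
            prefixSet (max N i) (fun j => if hj : j < max N i + 1 then w.1 ⟨j, hj⟩ else v) := by
        ext Y
        simp only [Set.mem_preimage, Set.mem_singleton_iff, Set.mem_iUnion, prefixSet,
          Set.mem_ofPred_eq]
        constructor
        · rintro rfl
          refine ⟨⟨fun j => Y j, rfl⟩, fun j hj => ?_⟩
          rw [dif_pos (Nat.lt_succ_of_le hj)]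
        · rintro ⟨w, hw⟩
          rw [hw i (le_max_right _ _), dif_pos (by omega), w.2]
      rw [hv]
      exact MeasurableSet.iUnion fun w =>
        MeasurableSpace.measurableSet_generateFrom ⟨_, le_max_left _ _, _, rfl⟩
    · rintro _ ⟨n, -, y, rfl⟩
      exact measurableSet_prefixSet n y
  have hpi : IsPiSystem C := by
    rintro _ ⟨n, hn, y, rfl⟩ _ ⟨m, hm, z, rfl⟩ ⟨Y, h1, h2⟩
    refine ⟨max n m, le_max_of_le_left hn, Y, ?_⟩
    ext Z
    simp only [prefixSet, Set.mem_inter_iff, Set.mem_ofPred_eq] at h1 h2 ⊢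
    refine ⟨fun h i hi => ?_, fun h => ⟨fun i hi => ?_, fun i hi => ?_⟩⟩
    · rcases le_max_iff.1 hi with hi | hi
      · rw [h.1 i hi, h1 i hi]
      · rw [h.2 i hi, h2 i hi]
    · rw [h i (le_max_of_le_left hi), h1 i hi]
    · rw [h i (le_max_of_le_right hi), h2 i hi]
  refine ext_of_generate_finite C hgen hpi ?_ (by simp)
  rintro _ ⟨n, hn, y, rfl⟩
  exact h n hn y

instance : IsMarkovKernel (chainKernel Γ) := by
  unfold chainKernel
  exact Kernel.IsMarkovKernel.map _
    (measurable_pi_lambda _ fun n => measurable_snd.comp (measurable_pi_apply n))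

open scoped Classical in
-- The environment is a coordinate of the chain, so its constancy has to be proved together with the
-- path probabilities. The test function `f` is arbitrary so that the induction can absorb the last
-- transition probability into it.
lemma lintegral_histKernel_traj (ω : Env Γ) (x : Vertex d) (n : ℕ) (y : ℕ → Vertex d)
    {f : Env Γ → ℝ≥0∞} (hf : Measurable f) :
    ∫⁻ ξ, (if ∀ i ≤ n, (ξ i).2 = y i then 1 else 0) * f (ξ n).1
        ∂Kernel.traj (X := fun _ => Env Γ × Vertex d) (histKernel Γ) 0 (fun _ => (ω, x)) =
      (if x = y 0 then 1 else 0) * (∏ i ∈ Finset.range n, jumpMeasure ω (y i) {y (i + 1)}) *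
        f ω := by
  induction n generalizing f with
  | zero =>
    have := lintegral_traj_frestrictLe_zero (X := fun _ => Env Γ × Vertex d) (histKernel Γ)
      (fun _ => (ω, x)) (G := fun h => (if (h ⟨0, by simp⟩).2 = y 0 then 1 else 0) *
        f (h ⟨0, by simp⟩).1) ?_
    · simp only [Nat.le_zero, forall_eq, Finset.range_zero, Finset.prod_empty, mul_one]
      convert! this
    · refine Measurable.mul (Measurable.ite ?_ measurable_const measurable_const) (by fun_prop)
      exact (by fun_prop : Measurable fun h : (Π _ : Finset.Iic 0, Env Γ × Vertex d) =>
        (h ⟨0, _⟩).2) (measurableSet_singleton (y 0))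
  | succ n ih =>
    have hG : Measurable fun h : (Π _ : Finset.Iic n, Env Γ × Vertex d) =>
        if ∀ i : Finset.Iic n, (h i).2 = y i then (1 : ℝ≥0∞) else 0 := by
      refine Measurable.ite ?_ measurable_const measurable_const
      rw [Set.ofPred_forall]
      exact MeasurableSet.iInter fun i =>
        (by fun_prop : Measurable fun h : (Π _ : Finset.Iic n, Env Γ × Vertex d) => (h i).2)
          (measurableSet_singleton (y i))
    have hind : Measurable fun v : Vertex d => if v = y (n + 1) then (1 : ℝ≥0∞) else 0 :=
      measurable_of_countable _
    have hg : Measurable fun w : Env Γ × Vertex d =>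
        f w.1 * (if w.2 = y (n + 1) then (1 : ℝ≥0∞) else 0) :=
      (hf.comp measurable_fst).mul (hind.comp measurable_snd)
    have hstep : ∀ w : Env Γ × Vertex d, ∫⁻ v, f v.1 * (if v.2 = y (n + 1) then (1 : ℝ≥0∞) else 0)
        ∂stepKernel Γ w = f w.1 * jumpMeasure w.1 w.2 {y (n + 1)} := by
      intro w
      rw [stepKernel, Kernel.prod_apply, Kernel.deterministic_apply, lintegral_prod _
        hg.aemeasurable, lintegral_dirac' _ (Measurable.lintegral_prod_right' hg)]
      refine (lintegral_const_mul (f w.1) hind).trans ?_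
      congr 1
      have : (fun v : Vertex d => if v = y (n + 1) then (1 : ℝ≥0∞) else 0) =
          ({y (n + 1)} : Set (Vertex d)).indicator 1 := by
        ext v; simp [Set.indicator_apply]
      rw [this, lintegral_indicator_one (measurableSet_singleton _)]
      rfl
    have hJ : Measurable fun ω : Env Γ => f ω * jumpMeasure ω (y n) {y (n + 1)} :=
      hf.mul ((Measure.measurable_coe (measurableSet_singleton _)).comp
        (measurable_jumpMeasure.comp (measurable_id.prodMk measurable_const)))
    have key := lintegral_traj_succ (X := fun _ => Env Γ × Vertex d) (histKernel Γ) n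
      (fun _ => (ω, x)) hG hg
    have hL : ∀ ξ : ℕ → Env Γ × Vertex d,
        (if ∀ i ≤ n + 1, (ξ i).2 = y i then (1 : ℝ≥0∞) else 0) * f (ξ (n + 1)).1 =
        (if ∀ i : Finset.Iic n, (Preorder.frestrictLe (π := fun _ => Env Γ × Vertex d) n ξ i).2 = y i
          then 1 else 0) *
          (f (ξ (n + 1)).1 * (if (ξ (n + 1)).2 = y (n + 1) then 1 else 0)) := by
      intro ξ
      have hiff : (∀ i ≤ n + 1, (ξ i).2 = y i) ↔ (∀ i : Finset.Iic n,
          (Preorder.frestrictLe (π := fun _ => Env Γ × Vertex d) n ξ i).2 = y i) ∧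
            (ξ (n + 1)).2 = y (n + 1) := by
        simp only [Preorder.frestrictLe_apply, Subtype.forall, Finset.mem_Iic]
        refine ⟨fun h => ⟨fun i hi => h i (by omega), h _ le_rfl⟩, fun h i hi => ?_⟩
        rcases Nat.le_succ_iff.1 hi with hi | rfl
        · exact h.1 i hi
        · exact h.2
      rw [if_congr hiff rfl rfl]
      by_cases h1 : ∀ i : Finset.Iic n,
          (Preorder.frestrictLe (π := fun _ => Env Γ × Vertex d) n ξ i).2 = y i
      · by_cases h2 : (ξ (n + 1)).2 = y (n + 1)
        · rw [if_pos ⟨h1, h2⟩, if_pos h1, if_pos h2, mul_one]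
        · rw [if_neg fun h => h2 h.2, if_neg h2, mul_zero, mul_zero, zero_mul]
      · rw [if_neg fun h => h1 h.1, if_neg h1, zero_mul, zero_mul]
    rw [lintegral_congr hL, key, Finset.prod_range_succ]
    have hR : ∀ ξ : ℕ → Env Γ × Vertex d,
        (if ∀ i : Finset.Iic n, (Preorder.frestrictLe (π := fun _ => Env Γ × Vertex d) n ξ i).2 = y i
          then (1 : ℝ≥0∞) else 0) * ∫⁻ z, f z.1 * (if z.2 = y (n + 1) then 1 else 0)
            ∂histKernel Γ n (Preorder.frestrictLe (π := fun _ => Env Γ × Vertex d) n ξ) =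
        (if ∀ i ≤ n, (ξ i).2 = y i then 1 else 0) *
          (f (ξ n).1 * jumpMeasure (ξ n).1 (y n) {y (n + 1)}) := by
      intro ξ
      have : histKernel Γ n (Preorder.frestrictLe (π := fun _ => Env Γ × Vertex d) n ξ) =
        stepKernel Γ (ξ n) := rfl
      rw [this, hstep]
      simp only [Preorder.frestrictLe_apply, Subtype.forall, Finset.mem_Iic]
      split_ifs with h
      · rw [h n le_rfl]
      · simp
    rw [lintegral_congr hR, ih hJ]
    ring

open scoped Classical in
lemma chainKernel_prefixSet (ω : Env Γ) (x : Vertex d) (n : ℕ) (y : ℕ → Vertex d) :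
    chainKernel Γ (ω, x) (prefixSet n y) =
      (if x = y 0 then 1 else 0) * ∏ i ∈ Finset.range n, jumpMeasure ω (y i) {y (i + 1)} := by
  have hm : Measurable fun (ξ : ℕ → Env Γ × Vertex d) n => (ξ n).2 :=
    measurable_pi_lambda _ fun n => measurable_snd.comp (measurable_pi_apply n)
  have := lintegral_histKernel_traj ω x n y (f := 1) measurable_one
  simp only [Pi.one_apply, mul_one] at this
  rw [← this, chainKernel, Kernel.map_apply _ hm,
    Measure.map_apply hm (measurableSet_prefixSet n y), Kernel.comap_apply,
    ← lintegral_indicator_one (hm (measurableSet_prefixSet n y))]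
  refine lintegral_congr fun ξ => ?_
  simp [Set.indicator_apply, prefixSet]

lemma ae_chainKernel_zero (ω : Env Γ) (x : Vertex d) : ∀ᵐ Y ∂chainKernel Γ (ω, x), Y 0 = x := by
  have h := chainKernel_prefixSet ω x 0 (fun _ => x)
  rw [if_pos rfl, Finset.prod_range_zero, one_mul] at h
  filter_upwards [(mem_ae_iff_prob_eq_one (measurableSet_prefixSet 0 fun _ => x)).2 h] with Y hY
  exact hY 0 le_rfl

/-- The sequence that follows `Y` before the index `n` and continues with `Y'` from there on. -/
def glue {α : Type*} (n : ℕ) (Y Y' : ℕ → α) : ℕ → α := fun i => if i < n then Y i else Y' (i - n)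

@[simp] lemma glue_add {α : Type*} (n k : ℕ) (Y Y' : ℕ → α) : glue n Y Y' (n + k) = Y' k := by
  simp [glue]

lemma glue_of_lt {α : Type*} {n k : ℕ} (h : k < n) (Y Y' : ℕ → α) : glue n Y Y' k = Y k := by
  simp [glue, h]

lemma measurable_glue {α : Type*} [MeasurableSpace α] (n : ℕ) :
    Measurable fun p : (ℕ → α) × (ℕ → α) => glue n p.1 p.2 := by
  refine measurable_pi_lambda _ fun i => ?_
  unfold glue
  split_ifs <;> fun_prop

/-- The Markov property of the jump chain at the time `n`. -/
lemma lintegral_chainKernel_glue (ω : Env Γ) (x : Vertex d) (n : ℕ) {f : (ℕ → Vertex d) → ℝ≥0∞}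
    (hf : Measurable f) :
    ∫⁻ Y, f Y ∂chainKernel Γ (ω, x) =
      ∫⁻ Y, ∫⁻ Y', f (glue n Y Y') ∂chainKernel Γ (ω, Y n) ∂chainKernel Γ (ω, x) := by
  classical
  have hc : Measurable fun Y : ℕ → Vertex d => (ω, Y n) := by fun_prop
  have key : chainKernel Γ (ω, x) = (chainKernel Γ (ω, x) ⊗ₘ
      (chainKernel Γ).comap (fun Y : ℕ → Vertex d => (ω, Y n)) hc).map
        fun p => glue n p.1 p.2 := by
    have := Measure.isProbabilityMeasure_map (μ := chainKernel Γ (ω, x) ⊗ₘ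
      (chainKernel Γ).comap (fun Y : ℕ → Vertex d => (ω, Y n)) hc)
        (measurable_glue (α := Vertex d) n).aemeasurable
    -- Only prefixes reaching at least to `n` are tested: their path probability factorises at the
    -- index `n`.
    refine ext_of_prefixSet n fun m hm y => ?_
    obtain ⟨k, rfl⟩ := Nat.exists_eq_add_of_le hm
    have hS := measurable_glue (α := Vertex d) n (measurableSet_prefixSet (n + k) y)
    rw [Measure.map_apply (measurable_glue n) (measurableSet_prefixSet _ y),
      Measure.compProd_apply hS]
    have hsec : ∀ Y : ℕ → Vertex d, (chainKernel Γ).comap (fun Y : ℕ → Vertex d => (ω, Y n)) hc Y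
        (Prod.mk Y ⁻¹' ((fun p : (ℕ → Vertex d) × (ℕ → Vertex d) => glue n p.1 p.2) ⁻¹'
          prefixSet (n + k) y)) = (prefixSet n y).indicator (fun _ =>
            ∏ i ∈ Finset.range k, jumpMeasure ω (y (n + i)) {y (n + i + 1)}) Y := by
      intro Y
      have hset : (Prod.mk Y ⁻¹' ((fun p : (ℕ → Vertex d) × (ℕ → Vertex d) => glue n p.1 p.2) ⁻¹'
          prefixSet (n + k) y)) = if ∀ i < n, Y i = y i then prefixSet k (fun j => y (n + j))
            else ∅ := by
        ext Y'
        split_ifs with h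
        · simp only [Set.mem_preimage, prefixSet, Set.mem_ofPred_eq]
          constructor
          · intro h' i hi
            simpa using h' (n + i) (by omega)
          · intro h' i hi
            rcases lt_or_ge i n with hin | hin
            · rw [glue_of_lt hin, h i hin]
            · obtain ⟨j, rfl⟩ := Nat.exists_eq_add_of_le hin
              rw [glue_add, h' j (by omega)]
        · simp only [Set.mem_preimage, prefixSet, Set.mem_ofPred_eq, Set.mem_empty_iff_false,
            iff_false]
          intro h'
          exact h fun i hi => by simpa [glue_of_lt hi] using h' i (by omega)
      -- The index `n` itself is taken from the continuation, which starts at `Y n`; this is what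
      -- forces `Y n = y n`.
      have hiff : Y ∈ prefixSet n y ↔ (∀ i < n, Y i = y i) ∧ Y n = y n := by
        refine ⟨fun h => ⟨fun i hi => h i hi.le, h n le_rfl⟩, fun h i hi => ?_⟩
        rcases hi.lt_or_eq with hi | rfl
        · exact h.1 i hi
        · exact h.2
      rw [Kernel.comap_apply, hset, Set.indicator_apply, hiff]
      by_cases h1 : ∀ i < n, Y i = y i
      · by_cases h2 : Y n = y n
        · rw [if_pos h1, if_pos ⟨h1, h2⟩, chainKernel_prefixSet]
          simp [h2, add_assoc]
        · rw [if_pos h1, if_neg fun h => h2 h.2, chainKernel_prefixSet]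
          simp [h2]
      · rw [if_neg h1, if_neg fun h => h1 h.1, measure_empty]
    simp only [hsec]
    rw [lintegral_indicator_const (measurableSet_prefixSet n y), chainKernel_prefixSet,
      chainKernel_prefixSet, Finset.prod_range_add]
    ring
  conv_lhs => rw [key]
  rw [lintegral_map hf (measurable_glue n)]
  exact Measure.lintegral_compProd (hf.comp (measurable_glue n))

lemma chainKernel_shift (z : Vertex d) (ω : Env Γ) (x : Vertex d) :
    chainKernel Γ (ω, z + x) = (chainKernel Γ (shift z ω, x)).map fun Y i => z + Y i := by
  classical
  have hm : Measurable fun (Y : ℕ → Vertex d) i => z + Y i := by fun_prop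
  have := Measure.isProbabilityMeasure_map (μ := chainKernel Γ (shift z ω, x)) hm.aemeasurable
  refine ext_of_prefixSet 0 fun n _ y => ?_
  have hpre : (fun (Y : ℕ → Vertex d) i => z + Y i) ⁻¹' prefixSet n y =
      prefixSet n (fun i => -z + y i) := by
    ext Y
    simp only [prefixSet, Set.mem_preimage, Set.mem_ofPred_eq, eq_neg_add_iff_add_eq]
  rw [Measure.map_apply hm (measurableSet_prefixSet n y), hpre, chainKernel_prefixSet,
    chainKernel_prefixSet]
  simp [jumpMeasure_shift, eq_neg_add_iff_add_eq]

/-- An infinite product of copies of a probability measure is the law of two independent copies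
glued together. -/
lemma infinitePi_map_glue {α : Type*} [MeasurableSpace α] (ν : Measure α) [IsProbabilityMeasure ν]
    (n : ℕ) :
    ((Measure.infinitePi fun _ : ℕ => ν).prod (Measure.infinitePi fun _ : ℕ => ν)).map
      (fun p => glue n p.1 p.2) = Measure.infinitePi fun _ : ℕ => ν := by
  refine Measure.eq_infinitePi _ fun s t ht => ?_
  rw [Measure.map_apply (measurable_glue n)
    (MeasurableSet.pi s.countable_toSet fun i _ => ht i)]
  -- A cylinder splits into its coordinates below `n` and the remaining ones, re-indexed from zero.
  have hset : (fun p : (ℕ → α) × (ℕ → α) => glue n p.1 p.2) ⁻¹' Set.pi s t =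
      (Set.pi ↑(s.filter (· < n)) t) ×ˢ
        (Set.pi ↑((s.filter (¬ · < n)).image (· - n)) fun i => t (n + i)) := by
    ext ⟨Y, Y'⟩
    simp only [Set.mem_preimage, Set.mem_pi, Finset.mem_coe, Set.mem_prod, Finset.mem_filter,
      Finset.mem_image]
    constructor
    · refine fun h => ⟨fun i hi => by simpa [glue_of_lt hi.2] using h i hi.1, ?_⟩
      rintro _ ⟨i, ⟨hi, hin⟩, rfl⟩
      have := h i hi
      rw [glue, if_neg hin] at this
      rwa [Nat.add_sub_cancel' (not_lt.1 hin)]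
    · rintro ⟨h1, h2⟩ i hi
      by_cases hin : i < n
      · simpa [glue_of_lt hin] using h1 i ⟨hi, hin⟩
      · have := h2 (i - n) ⟨i, ⟨hi, hin⟩, rfl⟩
        rw [Nat.add_sub_cancel' (not_lt.1 hin)] at this
        rwa [glue, if_neg hin]
  rw [hset, Measure.prod_prod, Measure.infinitePi_pi _ (fun i _ => ht i),
    Measure.infinitePi_pi _ (fun i _ => ht _), Finset.prod_image,
    ← Finset.prod_filter_mul_prod_filter_not s (· < n)]
  · congr 1
    refine Finset.prod_congr rfl fun i hi => ?_
    rw [Nat.add_sub_cancel' (not_lt.1 (Finset.mem_filter.1 hi).2)]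
  · intro i hi j hj hij
    have h1 := (Finset.mem_filter.1 hi).2
    have h2 := (Finset.mem_filter.1 hj).2
    simp only at hij
    omega

/-! ### The Markov property of the quenched law and the restarted walk -/

/-- The law of the clocks. -/
abbrev clockLaw : Measure (ℕ → ℝ) := Measure.infinitePi fun _ : ℕ => expMeasure 1

lemma quenchedLaw_apply (p : Env Γ × Vertex d) :
    quenchedLaw Γ p = (chainKernel Γ p).prod clockLaw := by
  rw [quenchedLaw, Kernel.prod_apply, Kernel.const_apply]

lemma lintegral_quenchedLaw (p : Env Γ × Vertex d) {f : Traj d → ℝ≥0∞} (hf : Measurable f) :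
    ∫⁻ ξ, f ξ ∂quenchedLaw Γ p = ∫⁻ Y, ∫⁻ e, f (Y, e) ∂clockLaw ∂chainKernel Γ p := by
  rw [quenchedLaw_apply, lintegral_prod _ hf.aemeasurable]

lemma ae_quenchedLaw_zero (ω : Env Γ) (x : Vertex d) :
    ∀ᵐ ξ ∂quenchedLaw Γ (ω, x), ξ.1 0 = x := by
  rw [quenchedLaw_apply]
  exact Measure.quasiMeasurePreserving_fst.ae (ae_chainKernel_zero ω x)

/-- The trajectory that follows `ξ` before the `n`-th jump and continues with `ξ'`. -/
def Traj.glue (n : ℕ) (ξ ξ' : Traj d) : Traj d :=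
  (CyclicWalk.glue n ξ.1 ξ'.1, CyclicWalk.glue n ξ.2 ξ'.2)

lemma Traj.measurable_glue (n : ℕ) :
    Measurable fun p : Traj d × Traj d => Traj.glue n p.1 p.2 :=
  ((CyclicWalk.measurable_glue n).comp
    ((measurable_fst.comp measurable_fst).prodMk (measurable_fst.comp measurable_snd))).prodMk
  ((CyclicWalk.measurable_glue n).comp
    ((measurable_snd.comp measurable_fst).prodMk (measurable_snd.comp measurable_snd)))

/-- The Markov property of the quenched law at the `n`-th jump. -/
lemma lintegral_quenchedLaw_glue (ω : Env Γ) (x : Vertex d) (n : ℕ) {f : Traj d → ℝ≥0∞}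
    (hf : Measurable f) :
    ∫⁻ ξ, f ξ ∂quenchedLaw Γ (ω, x) =
      ∫⁻ ξ, ∫⁻ ξ', f (Traj.glue n ξ ξ') ∂quenchedLaw Γ (ω, ξ.1 n) ∂quenchedLaw Γ (ω, x) := by
  have hg := Traj.measurable_glue (d := d) n
  have hk : Measurable fun ξ : Traj d => (ω, ξ.1 n) := by fun_prop
  have hF : Measurable fun ξ : Traj d =>
      ∫⁻ ξ', f (Traj.glue n ξ ξ') ∂quenchedLaw Γ (ω, ξ.1 n) :=
    Measurable.lintegral_kernel_prod_right' (κ := (quenchedLaw Γ).comap _ hk) (hf.comp hg)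
  rw [lintegral_quenchedLaw _ hf, lintegral_quenchedLaw _ hF,
    lintegral_chainKernel_glue ω x n hf.lintegral_prod_right']
  refine lintegral_congr fun Y => ?_
  have hfY : ∀ Y' : ℕ → Vertex d, Measurable fun e => f (CyclicWalk.glue n Y Y', e) :=
    fun Y' => hf.comp measurable_prodMk_left
  have h1 : ∀ Y' : ℕ → Vertex d, ∫⁻ e, f (CyclicWalk.glue n Y Y', e) ∂clockLaw =
      ∫⁻ e, ∫⁻ e', f (Traj.glue n (Y, e) (Y', e')) ∂clockLaw ∂clockLaw := by
    intro Y'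
    conv_lhs => rw [clockLaw, ← infinitePi_map_glue (expMeasure 1) n]
    rw [lintegral_map (hfY Y') (CyclicWalk.measurable_glue n)]
    exact lintegral_prod _ ((hfY Y').comp (CyclicWalk.measurable_glue n)).aemeasurable
  have h2 : ∀ e : ℕ → ℝ, ∫⁻ ξ', f (Traj.glue n (Y, e) ξ') ∂quenchedLaw Γ (ω, Y n) =
      ∫⁻ Y', ∫⁻ e', f (Traj.glue n (Y, e) (Y', e')) ∂clockLaw ∂chainKernel Γ (ω, Y n) :=
    fun e => lintegral_quenchedLaw _ (hf.comp (hg.comp measurable_prodMk_left))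
  simp only [h1, h2]
  -- Both sides integrate the same function; only the past clocks and the future chain come in
  -- opposite orders.
  refine lintegral_lintegral_swap (Measurable.aemeasurable ?_)
  have : Measurable fun p : ((ℕ → Vertex d) × (ℕ → ℝ)) × (ℕ → ℝ) =>
      f (Traj.glue n (Y, p.1.2) (p.1.1, p.2)) := by
    refine hf.comp (hg.comp (g := fun p : Traj d × Traj d => Traj.glue n p.1 p.2)
      (f := fun p : ((ℕ → Vertex d) × (ℕ → ℝ)) × (ℕ → ℝ) =>
        (((Y, p.1.2), (p.1.1, p.2)) : Traj d × Traj d)) (by fun_prop))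
  exact this.lintegral_prod_right'

lemma measurable_translate (x : Vertex d) :
    Measurable fun ξ : Traj d => ((fun i => x + ξ.1 i, ξ.2) : Traj d) := by
  refine Measurable.prodMk (measurable_pi_lambda _ fun i => ?_) measurable_snd
  exact (measurable_of_countable fun v : Vertex d => x + v).comp (by fun_prop)

lemma quenchedLaw_shift (z : Vertex d) (ω : Env Γ) (x : Vertex d) :
    quenchedLaw Γ (ω, z + x) =
      (quenchedLaw Γ (shift z ω, x)).map fun ξ => (fun i => z + ξ.1 i, ξ.2) := by
  have hm : Measurable fun (Y : ℕ → Vertex d) i => z + Y i := by fun_prop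
  rw [quenchedLaw_apply, quenchedLaw_apply, chainKernel_shift]
  have := Measure.map_prod_map (chainKernel Γ (shift z ω, x)) clockLaw hm measurable_id
  rw [Measure.map_id] at this
  exact this

/-- The environment seen from the position after the `n`-th jump, with the walk restarted there. -/
def restart (n : ℕ) (q : Env Γ × Traj d) : Env Γ × Traj d :=
  (shift (q.2.1 n) q.1, (fun i => -q.2.1 n + q.2.1 (n + i), fun i => q.2.2 (n + i)))

lemma measurable_restart (n : ℕ) : Measurable (restart n : Env Γ × Traj d → Env Γ × Traj d) := by
  refine Measurable.prodMk ?_ ?_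
  · exact measurable_shift_uncurry.comp (by fun_prop : Measurable fun q : Env Γ × Traj d =>
      (q.1, q.2.1 n))
  · refine Measurable.prodMk (measurable_pi_lambda _ fun i => ?_) (by fun_prop)
    exact (measurable_of_countable fun p : Vertex d × Vertex d => -p.1 + p.2).comp
      (by fun_prop : Measurable fun q : Env Γ × Traj d => (q.2.1 n, q.2.1 (n + i)))

lemma restart_restart (m n : ℕ) (q : Env Γ × Traj d) :
    restart n (restart m q) = restart (m + n) q := by
  simp [restart, shift_shift, add_assoc]

lemma restart_one_iterate (n : ℕ) {q : Env Γ × Traj d} (hq : q.2.1 0 = 0) :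
    (restart 1)^[n] q = restart n q := by
  induction n with
  | zero => simp [restart, hq]
  | succ n ih => rw [Function.iterate_succ_apply', ih, restart_restart]

/-- The Markov property of the restarted walk. -/
lemma lintegral_quenchedLaw_restart (ω : Env Γ) (x : Vertex d) (n : ℕ) {f : Traj d → ℝ≥0∞}
    (hf : Measurable f) (hfn : ∀ ξ ξ', f (Traj.glue n ξ ξ') = f ξ)
    {g : Env Γ × Traj d → ℝ≥0∞} (hg : Measurable g) :
    ∫⁻ ξ, f ξ * g (restart n (ω, ξ)) ∂quenchedLaw Γ (ω, x) =
      ∫⁻ ξ, f ξ * ∫⁻ ξ', g (shift (ξ.1 n) ω, ξ') ∂quenchedLaw Γ (shift (ξ.1 n) ω, 0)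
        ∂quenchedLaw Γ (ω, x) := by
  have hr : Measurable fun ξ : Traj d => g (restart n (ω, ξ)) :=
    hg.comp ((measurable_restart n).comp measurable_prodMk_left)
  rw [lintegral_quenchedLaw_glue ω x n (f := fun ξ => f ξ * g (restart n (ω, ξ))) (hf.mul hr)]
  refine lintegral_congr fun ξ => ?_
  simp only [hfn]
  have hrξ : Measurable fun ξ' : Traj d => g (restart n (ω, Traj.glue n ξ ξ')) :=
    hr.comp ((Traj.measurable_glue n).comp measurable_prodMk_left)
  refine (lintegral_const_mul (f ξ) hrξ).trans (congrArg (f ξ * ·) ?_)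
  set z := ξ.1 n
  have hlaw := quenchedLaw_shift z ω (0 : Vertex d)
  rw [add_zero] at hlaw
  rw [hlaw, lintegral_map hrξ (measurable_translate z)]
  -- `restart n` recentres at the first position of the continuation, which is `z` because `ξ'`
  -- almost surely starts at the origin.
  refine lintegral_congr_ae ((ae_quenchedLaw_zero (shift z ω) 0).mono fun ξ' hξ' => ?_)
  have h0 : ∀ {α : Type} (Y Y' : ℕ → α), CyclicWalk.glue n Y Y' n = Y' 0 := fun Y Y' =>
    glue_add n 0 Y Y'
  simp [restart, Traj.glue, h0, hξ']

lemma lintegral_quenchedLaw_one (ω : Env Γ) (x : Vertex d) (h : Vertex d → ℝ≥0∞) :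
    ∫⁻ ξ, h (ξ.1 1) ∂quenchedLaw Γ (ω, x) = ∫⁻ y, h y ∂jumpMeasure ω x := by
  classical
  have hh : Measurable h := measurable_of_countable h
  have h1 : (chainKernel Γ (ω, x)).map (fun Y => Y 1) = jumpMeasure ω x := by
    refine Measure.ext_of_singleton fun y => ?_
    rw [Measure.map_apply (measurable_pi_apply 1) (measurableSet_singleton y)]
    have := chainKernel_prefixSet ω x 1 (fun i => if i = 0 then x else y)
    simp only [if_true, one_mul, Finset.prod_range_one, zero_add, one_ne_zero, if_false] at this
    rw [← this]
    refine measure_congr (eventuallyEq_set.2 ((ae_chainKernel_zero ω x).mono fun Y hY => ?_))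
    simp only [Set.mem_preimage, Set.mem_singleton_iff, prefixSet, Set.mem_ofPred_eq]
    constructor
    · rintro h i hi
      interval_cases i <;> simp [hY, h]
    · intro h
      simpa using h 1 le_rfl
  rw [← h1, lintegral_map hh (measurable_pi_apply 1), quenchedLaw_apply,
    lintegral_prod _ (by fun_prop)]
  simp

/-! ### The annealed law -/

section Annealed

variable {P : Measure (Env Γ)}

lemma lintegral_annealedLaw [SFinite P] {f : Env Γ × Traj d → ℝ≥0∞} (hf : Measurable f) :
    ∫⁻ q, f q ∂annealedLaw P = ∫⁻ ω, ∫⁻ ξ, f (ω, ξ) ∂quenchedLaw Γ (ω, 0) ∂P := by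
  rw [annealedLaw, Measure.lintegral_compProd hf]
  rfl

lemma ae_annealedLaw_iff [SFinite P] {p : Env Γ × Traj d → Prop}
    (hp : MeasurableSet {q | p q}) :
    (∀ᵐ q ∂annealedLaw P, p q) ↔ ∀ᵐ ω ∂P, ∀ᵐ ξ ∂quenchedLaw Γ (ω, 0), p (ω, ξ) :=
  Measure.ae_compProd_iff hp

lemma measurable_lintegral_quenchedLaw {f : Env Γ × Traj d → ℝ≥0∞} (hf : Measurable f) :
    Measurable fun ω => ∫⁻ ξ, f (ω, ξ) ∂quenchedLaw Γ (ω, 0) :=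
  Measurable.lintegral_kernel_prod_right'
    (κ := (quenchedLaw Γ).comap (fun ω => (ω, (0 : Vertex d))) (by fun_prop)) hf

/-- The annealed law weighted with the total jump rate at the origin: the invariant law of the jump
chain. -/
def palmLaw (P : Measure (Env Γ)) : Measure (Env Γ × Traj d) :=
  annealedLaw (P.withDensity fun ω => muWeight ω 0)

instance [IsProbabilityMeasure P] : IsProbabilityMeasure (annealedLaw P) := by
  unfold annealedLaw; infer_instance

lemma isFiniteMeasure_palmLaw (hmu : ∫⁻ ω, muWeight ω 0 ∂P < ∞) :
    IsFiniteMeasure (palmLaw P) := by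
  have := isFiniteMeasure_withDensity hmu.ne
  unfold palmLaw annealedLaw
  infer_instance

variable [IsProbabilityMeasure P]

lemma lintegral_palmLaw {f : Env Γ × Traj d → ℝ≥0∞} (hf : Measurable f) :
    ∫⁻ q, f q ∂palmLaw P =
      ∫⁻ ω, muWeight ω 0 * ∫⁻ ξ, f (ω, ξ) ∂quenchedLaw Γ (ω, 0) ∂P := by
  rw [palmLaw, lintegral_annealedLaw hf, lintegral_withDensity_eq_lintegral_mul _
    (measurable_muWeight 0) (measurable_lintegral_quenchedLaw hf)]
  rfl

lemma palmLaw_absolutelyContinuous : palmLaw P ≪ annealedLaw P :=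
  Measure.AbsolutelyContinuous.compProd_left (withDensity_absolutelyContinuous _ _) _

/-- With `palmLaw_absolutelyContinuous`, almost sure statements pass freely between the two laws;
positivity of the density is what is used here. -/
lemma annealedLaw_absolutelyContinuous (hreg : ∀ᵐ ω ∂P, IsRegular ω) :
    annealedLaw P ≪ palmLaw P :=
  Measure.AbsolutelyContinuous.compProd_left (withDensity_absolutelyContinuous'
    (measurable_muWeight 0).aemeasurable (hreg.mono fun _ h => h.muWeight_ne_zero 0)) _

/-- The Markov property at the first jump reduces invariance on trajectories to that of the
environment chain, `lintegral_muWeight_jump`. -/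
lemma measurePreserving_restart_one (hP : IsShiftErgodic P) (hreg : ∀ᵐ ω ∂P, IsRegular ω) :
    MeasurePreserving (restart 1) (palmLaw P) (palmLaw P) := by
  refine ⟨measurable_restart 1, Measure.ext_of_lintegral _ fun g hg => ?_⟩
  rw [lintegral_map hg (measurable_restart 1), lintegral_palmLaw (hg.fun_comp (measurable_restart 1)),
    lintegral_palmLaw hg, ← lintegral_muWeight_jump hP hreg (measurable_lintegral_quenchedLaw hg)]
  refine lintegral_congr fun ω => congrArg (muWeight ω 0 * ·) ?_
  have := lintegral_quenchedLaw_restart ω 0 1 measurable_one (fun _ _ => rfl) hg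
  simp only [Pi.one_apply, one_mul] at this
  rw [this]
  exact lintegral_quenchedLaw_one ω 0 fun y =>
    ∫⁻ ξ, g (shift y ω, ξ) ∂quenchedLaw Γ (shift y ω, 0)

lemma ae_annealedLaw_of_quenched {p : Env Γ × Traj d → Prop} (hp : MeasurableSet {q | p q})
    (h : ∀ ω, ∀ᵐ ξ ∂quenchedLaw Γ (ω, 0), p (ω, ξ)) : ∀ᵐ q ∂annealedLaw P, p q :=
  (ae_annealedLaw_iff hp).2 (ae_of_all _ h)

lemma ae_annealedLaw_zero : ∀ᵐ q ∂annealedLaw P, q.2.1 0 = 0 :=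
  ae_annealedLaw_of_quenched ((by fun_prop : Measurable fun q : Env Γ × Traj d => q.2.1 0)
    (measurableSet_singleton 0)) fun ω => ae_quenchedLaw_zero ω 0

lemma measurePreserving_restart (hP : IsShiftErgodic P) (hreg : ∀ᵐ ω ∂P, IsRegular ω) (n : ℕ) :
    MeasurePreserving (restart n) (palmLaw P) (palmLaw P) := by
  have h := (measurePreserving_restart_one hP hreg).iterate n
  refine ⟨measurable_restart n, Eq.trans (Measure.map_congr ?_) h.map_eq⟩
  filter_upwards [palmLaw_absolutelyContinuous.ae_le ae_annealedLaw_zero] with q hq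
  exact (restart_one_iterate n hq).symm

end Annealed

/-! ### Jump times and the walk along a trajectory -/

lemma holdingTime_restart (n k : ℕ) (q : Env Γ × Traj d) :
    holdingTime (restart n q).1 (restart n q).2 k = holdingTime q.1 q.2 (n + k) := by
  simp [holdingTime, restart, muWeight_shift]

lemma jumpTime_add (n k : ℕ) (q : Env Γ × Traj d) :
    jumpTime q.1 q.2 (n + k) =
      jumpTime q.1 q.2 n + jumpTime (restart n q).1 (restart n q).2 k := by
  simp [jumpTime, Finset.sum_range_add, holdingTime_restart]

lemma jumpTime_mono (ω : Env Γ) (ξ : Traj d) : Monotone (jumpTime ω ξ) := fun _ _ h =>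
  Finset.sum_le_sum_of_subset (Finset.range_mono h)

lemma measurable_holdingTime_zero :
    Measurable fun q : Env Γ × Traj d => holdingTime q.1 q.2 0 := by
  have : (fun q : Env Γ × Traj d => holdingTime q.1 q.2 0) = fun q => jumpTime q.1 q.2 1 := by
    ext q; simp [jumpTime]
  rw [this]
  exact measurable_jumpTime 1

lemma explosionTime_eq_tsum (ω : Env Γ) (ξ : Traj d) :
    explosionTime ω ξ = ∑' n, holdingTime ω ξ n := ENNReal.tsum_eq_iSup_nat.symm

lemma walk_eq {ω : Env Γ} {ξ : Traj d} {t : ℝ≥0} {n : ℕ} (h1 : jumpTime ω ξ n ≤ t)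
    (h2 : (t : ℝ≥0∞) < jumpTime ω ξ (n + 1)) : walk ω ξ t = ξ.1 n := by
  classical
  have h : ∃ n, (t : ℝ≥0∞) < jumpTime ω ξ (n + 1) := ⟨n, h2⟩
  have hn : Nat.find h = n := (Nat.find_eq_iff h).2 ⟨h2, fun m hm hlt =>
    (hlt.trans_le (jumpTime_mono ω ξ hm)).not_ge h1⟩
  unfold walk
  rw [dif_pos h]
  convert congrArg ξ.1 hn

lemma exists_jumpTime_le_lt {ω : Env Γ} {ξ : Traj d} (h : explosionTime ω ξ = ∞) (t : ℝ≥0) :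
    ∃ n, jumpTime ω ξ n ≤ t ∧ (t : ℝ≥0∞) < jumpTime ω ξ (n + 1) := by
  classical
  have hex : ∃ n, (t : ℝ≥0∞) < jumpTime ω ξ n :=
    lt_iSup_iff.1 (by rw [← explosionTime, h]; exact ENNReal.coe_lt_top)
  rcases hn : Nat.find hex with _ | n
  · have := Nat.find_spec hex
    rw [hn] at this
    simp [jumpTime] at this
  · refine ⟨n, not_lt.1 (Nat.find_min hex (by omega)), ?_⟩
    rw [← hn]
    exact Nat.find_spec hex

lemma hasFinitelyManyJumps_walk {ω : Env Γ} {ξ : Traj d} (h : explosionTime ω ξ = ∞) :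
    HasFinitelyManyJumps (walk ω ξ) := by
  intro T
  obtain ⟨N, -, hN⟩ := exists_jumpTime_le_lt h T
  -- `T` lies before the jump `N + 1`, and the walk is locally constant strictly between jumps, so
  -- only the jump times with index at most `N` matter.
  refine ((Finset.range (N + 1)).finite_toSet.image
    fun n => (jumpTime ω ξ n).toNNReal).subset ?_
  rintro t ⟨htT, ht⟩
  obtain ⟨n, h1, h2⟩ := exists_jumpTime_le_lt h t
  refine ⟨n, Finset.mem_coe.2 (Finset.mem_range.2 ?_), ?_⟩
  · by_contra hn
    exact (hN.trans_le ((jumpTime_mono ω ξ (not_lt.1 hn)).trans h1)).not_ge (by exact_mod_cast htT)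
  · rcases h1.eq_or_lt with h1 | h1
    · simp [h1]
    · refine absurd ?_ ht
      filter_upwards [(ENNReal.continuous_coe.tendsto t).eventually (Ioo_mem_nhds h1 h2)] with s hs
      rw [walk_eq h1.le h2, walk_eq hs.1.le hs.2]

lemma HasFinitelyManyJumps.comp {α β : Type*} {p : ℝ≥0 → α} (hp : HasFinitelyManyJumps p)
    (f : α → β) : HasFinitelyManyJumps fun t => f (p t) := fun T =>
  (hp T).subset fun _ ht => ⟨ht.1, fun h => ht.2 (h.mono fun _ hs => congrArg f hs)⟩

/-- Joint measurability in the trajectory and the time is needed for sojourn integrals and for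
Fubini in the time variable. -/
lemma measurable_walk_uncurry :
    Measurable fun p : (Env Γ × Traj d) × ℝ≥0 => walk p.1.1 p.1.2 p.2 := by
  classical
  -- The second alternative makes the search succeed at index `0` when no jump time exceeds `t`,
  -- matching the default value `Y_0` of `walk`.
  let Q : ℕ → (Env Γ × Traj d) × ℝ≥0 → Prop := fun n p =>
    (p.2 : ℝ≥0∞) < jumpTime p.1.1 p.1.2 (n + 1) ∨
      ∀ m, ¬ (p.2 : ℝ≥0∞) < jumpTime p.1.1 p.1.2 (m + 1)
  have hS : ∀ n, MeasurableSet {p : (Env Γ × Traj d) × ℝ≥0 |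
      (p.2 : ℝ≥0∞) < jumpTime p.1.1 p.1.2 (n + 1)} := fun n =>
    measurableSet_lt (by fun_prop) ((measurable_jumpTime (n + 1)).comp measurable_fst)
  have hQ : ∀ n, MeasurableSet {p | Q n p} := fun n => by
    have h2 : MeasurableSet {p : (Env Γ × Traj d) × ℝ≥0 |
        ∀ m, ¬ (p.2 : ℝ≥0∞) < jumpTime p.1.1 p.1.2 (m + 1)} := by
      rw [Set.ofPred_forall]
      exact MeasurableSet.iInter fun m => (hS m).compl
    exact (hS n).union h2
  have hex : ∀ p, ∃ n, Q n p := fun p => by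
    by_cases h : ∃ n, (p.2 : ℝ≥0∞) < jumpTime p.1.1 p.1.2 (n + 1)
    · exact h.imp fun n hn => Or.inl hn
    · exact ⟨0, Or.inr (not_exists.1 h)⟩
  have key := Measurable.find (f := fun n (p : (Env Γ × Traj d) × ℝ≥0) => p.1.2.1 n)
    (fun n => by fun_prop) hQ hex
  convert! key using 2 with p
  unfold walk
  split_ifs with h
  · refine congrArg p.1.2.1 ((Nat.find_eq_iff _).2 ⟨?_, fun m hm hlt => ?_⟩)
    · exact (Nat.find_spec (hex p)).resolve_right fun h' => h.elim fun m hm => h' m hm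
    · exact Nat.find_min (hex p) hm (Or.inl hlt)
  · have h0 : Q 0 p := Or.inr (not_exists.1 h)
    exact congrArg p.1.2.1 ((Nat.find_eq_zero (hex p)).2 h0).symm

/-- The path of the environment process along a trajectory. -/
def envPath (q : Env Γ × Traj d) : ℝ≥0 → Env Γ := fun t => envProcess q.1 q.2 t

lemma measurable_timeShift_envPath :
    Measurable fun p : (Env Γ × Traj d) × ℝ≥0 => timeShift p.2 (envPath p.1) := by
  refine measurable_pi_lambda _ fun t => ?_
  have h : Measurable fun p : (Env Γ × Traj d) × ℝ≥0 => walk p.1.1 p.1.2 (p.2 + t) :=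
    measurable_walk_uncurry.comp (by fun_prop :
      Measurable fun p : (Env Γ × Traj d) × ℝ≥0 => (p.1, p.2 + t))
  exact measurable_shift_uncurry.comp ((measurable_fst.comp measurable_fst).prodMk h)

lemma timeShift_timeShift {α : Type*} (s t : ℝ≥0) (p : ℝ≥0 → α) :
    timeShift s (timeShift t p) = timeShift (t + s) p := by
  ext u; simp [timeShift, add_assoc]

lemma measurable_timeShift (s : ℝ≥0) :
    Measurable (timeShift s : (ℝ≥0 → Env Γ) → ℝ≥0 → Env Γ) :=
  measurable_pi_lambda _ fun _ => measurable_pi_apply _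

/-- The trajectories along which the walk started at the origin is defined at all times. -/
structure IsRegularPath (q : Env Γ × Traj d) : Prop where
  regular : IsRegular q.1
  start : q.2.1 0 = 0
  clock_pos : ∀ n, 0 < q.2.2 n
  explosion : explosionTime q.1 q.2 = ∞

lemma explosionTime_restart {q : Env Γ × Traj d} (hq : IsRegular q.1) (n : ℕ) :
    explosionTime (restart n q).1 (restart n q).2 = ∞ ↔ explosionTime q.1 q.2 = ∞ := by
  have hfin : jumpTime q.1 q.2 n ≠ ∞ := by
    refine (ENNReal.sum_lt_top.2 fun k _ => ?_).ne
    exact ENNReal.div_lt_top ENNReal.ofReal_ne_top (hq.muWeight_ne_zero _)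
  rw [explosionTime_eq_tsum, explosionTime_eq_tsum,
    ← ENNReal.summable.sum_add_tsum_nat_add' (f := holdingTime q.1 q.2) (k := n)]
  simp only [holdingTime_restart, add_comm n]
  rw [ENNReal.add_eq_top]
  exact (or_iff_right hfin).symm

lemma IsRegularPath.holdingTime_ne_top {q : Env Γ × Traj d} (hq : IsRegularPath q) (n : ℕ) :
    holdingTime q.1 q.2 n ≠ ∞ :=
  (ENNReal.div_lt_top ENNReal.ofReal_ne_top (hq.regular.muWeight_ne_zero _)).ne

/-- Restarting at the first jump is the same as waiting for the first holding time. -/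
lemma IsRegularPath.envPath_restart {q : Env Γ × Traj d} (hq : IsRegularPath q) :
    envPath (restart 1 q) = timeShift (holdingTime q.1 q.2 0).toNNReal (envPath q) := by
  ext1 t
  obtain ⟨n, h1, h2⟩ := exists_jumpTime_le_lt ((explosionTime_restart hq.regular 1).2 hq.explosion) t
  have hJ : ∀ k, jumpTime q.1 q.2 (1 + k) =
      ((holdingTime q.1 q.2 0).toNNReal : ℝ≥0∞) + jumpTime (restart 1 q).1 (restart 1 q).2 k := by
    intro k
    rw [jumpTime_add, ENNReal.coe_toNNReal (hq.holdingTime_ne_top 0)]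
    simp [jumpTime]
  have hw : walk q.1 q.2 ((holdingTime q.1 q.2 0).toNNReal + t) = q.2.1 (1 + n) := by
    refine walk_eq ?_ ?_
    · rw [hJ, ENNReal.coe_add]; gcongr
    · rw [add_assoc, hJ, ENNReal.coe_add]
      exact ENNReal.add_lt_add_left ENNReal.coe_ne_top h2
  simp only [envPath, timeShift, envProcess, hw, walk_eq h1 h2]
  simp [restart, shift_shift]

/-- The trajectory whose first clock is reduced by `v`. -/
def advance (v : ℝ) (ξ : Traj d) : Traj d := (ξ.1, Function.update ξ.2 0 (ξ.2 0 - v))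

/-- Reducing the first clock amounts to a time shift. -/
lemma IsRegularPath.envPath_advance {q : Env Γ × Traj d} (hq : IsRegularPath q) {u : ℝ≥0}
    (hu : (u : ℝ≥0∞) < holdingTime q.1 q.2 0) :
    envPath (q.1, advance ((muWeight q.1 0).toReal * u) q.2) = timeShift u (envPath q) := by
  set ξ' := advance ((muWeight q.1 0).toReal * u) q.2
  have hm0 := hq.regular.muWeight_ne_zero 0
  have hm1 := hq.regular.muWeight_ne_top 0
  -- Removing `μ u` from the clock removes `u` from the holding time; `u < holdingTime` keeps the
  -- truncated subtraction exact.
  have h0 : (u : ℝ≥0∞) + holdingTime q.1 ξ' 0 = holdingTime q.1 q.2 0 := by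
    have h2 : ENNReal.ofReal ((muWeight q.1 0).toReal * u) = u * muWeight q.1 0 := by
      rw [ENNReal.ofReal_mul ENNReal.toReal_nonneg, ENNReal.ofReal_toReal hm1, mul_comm,
        ENNReal.ofReal_coe_nnreal]
    have h1 : holdingTime q.1 ξ' 0 = holdingTime q.1 q.2 0 - u := by
      simp only [holdingTime, ξ', advance, Function.update_self, hq.start]
      rw [ENNReal.ofReal_sub _ (by positivity), h2, ENNReal.sub_div fun _ _ => hm0,
        ENNReal.mul_div_cancel_right hm0 hm1]
    rw [h1, add_tsub_cancel_of_le hu.le]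
  have hk : ∀ k, holdingTime q.1 ξ' (k + 1) = holdingTime q.1 q.2 (k + 1) := fun k => by
    simp [holdingTime, ξ', advance]
  -- The zeroth jump time stays `0`, so the relation starts at index one and `n = 0` is treated
  -- separately below.
  have hJ : ∀ k, (u : ℝ≥0∞) + jumpTime q.1 ξ' (k + 1) = jumpTime q.1 q.2 (k + 1) := by
    intro k
    rw [jumpTime, jumpTime, Finset.sum_range_succ', Finset.sum_range_succ', ← h0]
    simp only [hk]
    ring
  have hexp : explosionTime q.1 ξ' = ∞ := by
    have := hq.explosion
    rw [explosionTime_eq_tsum, tsum_eq_zero_add' ENNReal.summable] at this ⊢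
    simp only [hk]
    rw [ENNReal.add_eq_top] at this ⊢
    exact Or.inr (this.resolve_left (hq.holdingTime_ne_top 0))
  ext1 t
  obtain ⟨n, h1, h2⟩ := exists_jumpTime_le_lt hexp t
  have hw : walk q.1 q.2 (u + t) = q.2.1 n := by
    refine walk_eq ?_ ?_
    · rcases n with _ | n
      · simp [jumpTime]
      · rw [← hJ, ENNReal.coe_add]; gcongr
    · rw [← hJ, ENNReal.coe_add]
      exact ENNReal.add_lt_add_left ENNReal.coe_ne_top h2
  simp only [envPath, timeShift, envProcess, hw, walk_eq h1 h2]
  rfl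

/-! ### Non-explosion -/

section NonExplosion

variable {P : Measure (Env Γ)} [IsProbabilityMeasure P]

lemma expMeasure_eq_withDensity : expMeasure 1 = volume.withDensity (exponentialPDF 1) := rfl

lemma ae_expMeasure_pos : ∀ᵐ e ∂expMeasure 1, 0 < e := by
  have h0 : cdf (expMeasure 1) 0 = 0 := by rw [cdf_expMeasure_eq one_pos]; simp
  rw [ae_iff]
  have : {a : ℝ | ¬ 0 < a} = Set.Iic 0 := by ext; simp
  rw [this, ← ofReal_cdf, h0, ENNReal.ofReal_zero]

lemma ae_clockLaw_pos : ∀ᵐ e ∂clockLaw, ∀ n, 0 < e n :=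
  ae_all_iff.2 fun n => (measurePreserving_eval_infinitePi
    (fun _ : ℕ => expMeasure 1) n).quasiMeasurePreserving.ae ae_expMeasure_pos

lemma ae_quenchedLaw_clock_pos (p : Env Γ × Vertex d) :
    ∀ᵐ ξ ∂quenchedLaw Γ p, ∀ n, 0 < ξ.2 n := by
  rw [quenchedLaw_apply]
  exact Measure.quasiMeasurePreserving_snd.ae ae_clockLaw_pos

lemma measurable_explosionTime :
    Measurable fun q : Env Γ × Traj d => explosionTime q.1 q.2 :=
  Measurable.iSup fun n => measurable_jumpTime n

lemma ae_annealedLaw_isRegular (hreg : ∀ᵐ ω ∂P, IsRegular ω) :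
    ∀ᵐ q ∂annealedLaw P, IsRegular q.1 := by
  have h : (annealedLaw P).map Prod.fst = P := Measure.fst_compProd _ _
  exact ae_of_ae_map measurable_fst.aemeasurable (by rwa [h])

lemma ae_annealedLaw_clock_pos : ∀ᵐ q ∂annealedLaw P, ∀ n, 0 < q.2.2 n := by
  refine ae_annealedLaw_of_quenched ?_ fun ω => ae_quenchedLaw_clock_pos _
  simp only [Set.ofPred_forall]
  exact MeasurableSet.iInter fun n => measurableSet_lt measurable_const (by fun_prop)

/-- Poincaré recurrence for `restart 1`, which is conservative as it preserves a finite measure. The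
first holding time is positive, hence above some `1/k`; infinitely many later ones then are too,
which a convergent series excludes. -/
lemma ae_annealedLaw_explosion (hP : IsShiftErgodic P) (hreg : ∀ᵐ ω ∂P, IsRegular ω)
    (hmu : ∫⁻ ω, muWeight ω 0 ∂P < ∞) :
    ∀ᵐ q ∂annealedLaw P, explosionTime q.1 q.2 = ∞ := by
  have := isFiniteMeasure_palmLaw hmu
  refine (annealedLaw_absolutelyContinuous hreg).ae_le ?_
  have hcons := (measurePreserving_restart_one hP hreg).conservative
  have hm := measurable_holdingTime_zero (Γ := Γ)
  have hrec : ∀ᵐ q ∂palmLaw P, ∀ k : ℕ, (k : ℝ≥0∞)⁻¹ < holdingTime q.1 q.2 0 →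
      ∃ᶠ n in atTop, (restart 1)^[n] q ∈ {q | (k : ℝ≥0∞)⁻¹ < holdingTime q.1 q.2 0} :=
    ae_all_iff.2 fun k => hcons.ae_mem_imp_frequently_image_mem
      (measurableSet_lt measurable_const hm).nullMeasurableSet
  filter_upwards [hrec, palmLaw_absolutelyContinuous.ae_le (ae_annealedLaw_isRegular hreg),
    palmLaw_absolutelyContinuous.ae_le ae_annealedLaw_clock_pos,
    palmLaw_absolutelyContinuous.ae_le ae_annealedLaw_zero] with q h1 h2 h3 h4
  have hpos : holdingTime q.1 q.2 0 ≠ 0 :=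
    (ENNReal.div_pos (ENNReal.ofReal_pos.2 (h3 0)).ne' (h2.muWeight_ne_top _)).ne'
  obtain ⟨k, hk⟩ := ENNReal.exists_inv_nat_lt hpos
  by_contra hfin
  rw [explosionTime_eq_tsum] at hfin
  have hlim := ENNReal.tendsto_atTop_zero_of_tsum_ne_top hfin
  have hev := hlim.eventually_lt_const (u := (k : ℝ≥0∞)⁻¹) (by simp)
  obtain ⟨n, hn1, hn2⟩ := ((h1 k hk).and_eventually hev).exists
  rw [restart_one_iterate n h4] at hn1
  change (k : ℝ≥0∞)⁻¹ < holdingTime _ _ 0 at hn1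
  rw [holdingTime_restart, add_zero] at hn1
  exact hn1.not_gt hn2

lemma ae_annealedLaw_isRegularPath (hP : IsShiftErgodic P) (hreg : ∀ᵐ ω ∂P, IsRegular ω)
    (hmu : ∫⁻ ω, muWeight ω 0 ∂P < ∞) : ∀ᵐ q ∂annealedLaw P, IsRegularPath q := by
  filter_upwards [ae_annealedLaw_explosion hP hreg hmu, ae_annealedLaw_isRegular hreg,
    ae_annealedLaw_clock_pos, ae_annealedLaw_zero] with q h1 h2 h3 h4
  exact ⟨h2, h4, h3, h1⟩

lemma explosionTime_translate (ω : Env Γ) (x : Vertex d) (ξ : Traj d) :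
    explosionTime ω ((fun i => x + ξ.1 i, ξ.2) : Traj d) = explosionTime (shift x ω) ξ := by
  simp only [explosionTime, jumpTime, holdingTime, muWeight_shift]

/-- The walk does not explode, whatever its starting point. -/
lemma ae_explosionTime_eq_top (hP : IsShiftErgodic P) (hreg : ∀ᵐ ω ∂P, IsRegular ω)
    (hmu : ∫⁻ ω, muWeight ω 0 ∂P < ∞) :
    ∀ᵐ ω ∂P, ∀ x : Vertex d, ∀ᵐ ξ ∂quenchedLaw Γ (ω, x), explosionTime ω ξ = ∞ := by
  have hms : MeasurableSet {q : Env Γ × Traj d | explosionTime q.1 q.2 = ∞} :=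
    measurable_explosionTime (measurableSet_singleton ∞)
  have h0 := (ae_annealedLaw_iff (P := P) hms).1 (ae_annealedLaw_explosion hP hreg hmu)
  filter_upwards [hP.ae_forall_shift h0] with ω hω x
  -- The walk from `x` in `ω` is the translate by `x` of the walk from the origin in `shift x ω`.
  have hlaw := quenchedLaw_shift x ω 0
  rw [add_zero] at hlaw
  have hexp : MeasurableSet {ξ : Traj d | explosionTime ω ξ = ∞} :=
    measurable_prodMk_left (x := ω) hms
  rw [hlaw, ae_map_iff (measurable_translate x).aemeasurable hexp]
  filter_upwards [hω x] with ξ hξ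
  rw [explosionTime_translate, hξ]

end NonExplosion

/-! ### The law of the walk at fixed times -/

/-- Memorylessness of the exponential law, integrated over the elapsed time. -/
lemma lintegral_expMeasure_sub {G : ℝ → ℝ≥0∞} (hG : Measurable G) :
    ∫⁻ a, (∫⁻ v in Set.Icc 0 a, G (a - v)) ∂expMeasure 1 = ∫⁻ a, G a ∂expMeasure 1 := by
  have hpdf : Measurable (exponentialPDF 1) := (measurable_exponentialPDFReal 1).ennreal_ofReal
  have hone : ∫⁻ v, exponentialPDF 1 v = 1 := lintegral_exponentialPDF_eq_one one_pos
  let I : ℝ → ℝ → ℝ≥0∞ := fun a v => if 0 ≤ v ∧ v ≤ a then G (a - v) else 0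
  have hI : Measurable fun p : ℝ × ℝ => I p.1 p.2 := by
    refine Measurable.ite ?_ (hG.comp (by fun_prop)) measurable_const
    exact (measurableSet_le measurable_const measurable_snd).inter
      (measurableSet_le measurable_snd measurable_fst)
  have hinner : ∀ a, ∫⁻ v in Set.Icc 0 a, G (a - v) = ∫⁻ v, I a v := by
    intro a
    rw [← lintegral_indicator measurableSet_Icc]
    refine lintegral_congr fun v => ?_
    simp [I, Set.indicator_apply]
  have hpI : Measurable fun p : ℝ × ℝ => exponentialPDF 1 p.1 * I p.1 p.2 :=
    (hpdf.comp measurable_fst).mul hI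
  -- With `a = b + v` the density factorises as `e^{-b} e^{-v}`, and the elapsed time `v` integrates
  -- to one.
  have hmem : ∀ b v : ℝ, exponentialPDF 1 (b + v) * I (b + v) v =
      exponentialPDF 1 v * (exponentialPDF 1 b * G b) := by
    intro b v
    by_cases hv : 0 ≤ v
    · by_cases hb : 0 ≤ b
      · rw [exponentialPDF_of_nonneg hv, exponentialPDF_of_nonneg hb,
          exponentialPDF_of_nonneg (add_nonneg hb hv), ← mul_assoc,
          ← ENNReal.ofReal_mul (by positivity)]
        simp [I, hv, hb, mul_comm (Real.exp (-v)), Real.exp_add]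
      · rw [exponentialPDF_of_neg (not_le.1 hb)]
        simp [I, hb]
    · rw [exponentialPDF_of_neg (not_le.1 hv)]
      simp [I, hv]
  simp only [hinner]
  rw [expMeasure_eq_withDensity, lintegral_withDensity_eq_lintegral_mul _ hpdf
    hI.lintegral_prod_right', lintegral_withDensity_eq_lintegral_mul _ hpdf hG]
  calc ∫⁻ a, exponentialPDF 1 a * ∫⁻ v, I a v
      = ∫⁻ a, ∫⁻ v, exponentialPDF 1 a * I a v :=
        lintegral_congr fun a => (lintegral_const_mul _ (hI.comp measurable_prodMk_left)).symm
    _ = ∫⁻ v, ∫⁻ a, exponentialPDF 1 a * I a v := lintegral_lintegral_swap hpI.aemeasurable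
    _ = ∫⁻ v, ∫⁻ b, exponentialPDF 1 (b + v) * I (b + v) v :=
        lintegral_congr fun v =>
          (lintegral_add_right_eq_self (fun a => exponentialPDF 1 a * I a v) v).symm
    _ = ∫⁻ v, exponentialPDF 1 v * ∫⁻ b, exponentialPDF 1 b * G b := by
        simp only [hmem]
        exact lintegral_congr fun v => lintegral_const_mul _ (hpdf.mul hG)
    _ = ∫⁻ b, exponentialPDF 1 b * G b := by
        rw [lintegral_mul_const _ hpdf, hone, one_mul]

/-- Splitting off the clock with index zero as an independent coordinate reduces this to
`lintegral_expMeasure_sub`. -/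
lemma lintegral_clockLaw_update {f : (ℕ → ℝ) → ℝ≥0∞} (hf : Measurable f) :
    ∫⁻ e, (∫⁻ v in Set.Icc 0 (e 0), f (Function.update e 0 (e 0 - v))) ∂clockLaw =
      ∫⁻ e, f e ∂clockLaw := by
  let c : ℝ → (ℕ → ℝ) → ℕ → ℝ := fun a e => glue 1 (fun _ => a) e
  have hc : Measurable fun p : ℝ × (ℕ → ℝ) => c p.1 p.2 :=
    (measurable_glue 1).comp (by fun_prop :
      Measurable fun p : ℝ × (ℕ → ℝ) => ((fun _ => p.1 : ℕ → ℝ), p.2))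
  have hsplit : ∀ {F : (ℕ → ℝ) → ℝ≥0∞}, Measurable F →
      ∫⁻ e, F e ∂clockLaw = ∫⁻ e, ∫⁻ a, F (c a e) ∂expMeasure 1 ∂clockLaw := by
    intro F hF
    have hFc : Measurable fun p : ℝ × (ℕ → ℝ) => F (c p.1 p.2) := hF.comp hc
    conv_lhs => rw [clockLaw, ← infinitePi_map_glue (expMeasure 1) 1]
    rw [lintegral_map hF (measurable_glue 1)]
    refine (lintegral_prod_symm _ (hF.comp (measurable_glue 1)).aemeasurable).trans ?_
    refine lintegral_congr fun e => ?_
    refine Eq.trans ?_ ((measurePreserving_eval_infinitePi (fun _ : ℕ => expMeasure 1) 0).lintegral_comp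
      (f := fun a => F (c a e)) (hFc.comp measurable_prodMk_right))
    refine lintegral_congr fun e' => congrArg F (funext fun i => ?_)
    simp only [c, glue]
    split_ifs with h
    · rw [Nat.lt_one_iff.1 h]
    · rfl
  have hc0 : ∀ a e, c a e 0 = a := fun a e => by simp [c, glue]
  have hupd : ∀ a b e, Function.update (c a e) 0 b = c b e := by
    intro a b e
    ext i
    rcases i with _ | i <;> simp [c, glue]
  have hm : Measurable fun p : (ℕ → ℝ) × ℝ => f (Function.update p.1 0 (p.1 0 - p.2)) := by
    refine hf.comp (measurable_pi_lambda _ fun i => ?_)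
    by_cases hi : i = 0
    · subst hi; simp only [Function.update_self]; fun_prop
    · simp only [Function.update_of_ne hi]; fun_prop
  have hF : Measurable fun e : ℕ → ℝ =>
      ∫⁻ v in Set.Icc 0 (e 0), f (Function.update e 0 (e 0 - v)) := by
    have : ∀ e : ℕ → ℝ, ∫⁻ v in Set.Icc 0 (e 0), f (Function.update e 0 (e 0 - v)) =
        ∫⁻ v, {p : (ℕ → ℝ) × ℝ | 0 ≤ p.2 ∧ p.2 ≤ p.1 0}.indicator
          (fun p => f (Function.update p.1 0 (p.1 0 - p.2))) (e, v) := by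
      intro e
      rw [← lintegral_indicator measurableSet_Icc]
      rfl
    simp only [this]
    refine Measurable.lintegral_prod_right' (hm.indicator ?_)
    exact (measurableSet_le measurable_const measurable_snd).inter
      (measurableSet_le measurable_snd (by fun_prop))
  rw [hsplit hF, hsplit hf]
  refine lintegral_congr fun e => ?_
  simp only [hc0, hupd]
  exact lintegral_expMeasure_sub (G := fun a => f (c a e)) (hf.comp (hc.comp measurable_prodMk_right))

lemma measurable_advance :
    Measurable fun p : Traj d × ℝ => (advance p.2 p.1 : Traj d) := by
  refine Measurable.prodMk (by fun_prop) (measurable_pi_lambda _ fun i => ?_)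
  by_cases hi : i = 0
  · subst hi; simp only [Function.update_self]; fun_prop
  · simp only [Function.update_of_ne hi]; fun_prop

lemma lintegral_quenchedLaw_advance (p : Env Γ × Vertex d) {f : Traj d → ℝ≥0∞}
    (hf : Measurable f) :
    ∫⁻ ξ, (∫⁻ v in Set.Icc 0 (ξ.2 0), f (advance v ξ)) ∂quenchedLaw Γ p =
      ∫⁻ ξ, f ξ ∂quenchedLaw Γ p := by
  have hF : Measurable fun ξ : Traj d => ∫⁻ v in Set.Icc 0 (ξ.2 0), f (advance v ξ) := by
    have : ∀ ξ : Traj d, ∫⁻ v in Set.Icc 0 (ξ.2 0), f (advance v ξ) =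
        ∫⁻ v, {p : Traj d × ℝ | 0 ≤ p.2 ∧ p.2 ≤ p.1.2 0}.indicator
          (fun p => f (advance p.2 p.1)) (ξ, v) := by
      intro ξ
      rw [← lintegral_indicator measurableSet_Icc]
      rfl
    simp only [this]
    refine Measurable.lintegral_prod_right' ((hf.comp measurable_advance).indicator ?_)
    exact (measurableSet_le measurable_const measurable_snd).inter
      (measurableSet_le measurable_snd (by fun_prop))
  rw [lintegral_quenchedLaw _ hF, lintegral_quenchedLaw _ hf]
  refine lintegral_congr fun Y => ?_
  exact lintegral_clockLaw_update (f := fun e => f (Y, e)) (hf.comp measurable_prodMk_left)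

lemma setLIntegral_Ico_comp_mul {m : ℝ} (hm : 0 < m) {F : ℝ → ℝ≥0∞} (hF : Measurable F) (a : ℝ) :
    ∫⁻ v in Set.Ico 0 (m * a), F v = ENNReal.ofReal m * ∫⁻ u in Set.Ico 0 a, F (m * u) := by
  have hmap := Real.smul_map_volume_mul_left hm.ne'
  rw [← lintegral_indicator measurableSet_Ico, ← lintegral_indicator measurableSet_Ico]
  conv_lhs => rw [← hmap]
  rw [lintegral_smul_measure, abs_of_pos hm, lintegral_map (hF.indicator measurableSet_Ico)
    (by fun_prop), smul_eq_mul]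
  congr 1
  refine lintegral_congr fun u => ?_
  simp only [Set.indicator_apply, Set.mem_Ico, mul_nonneg_iff_of_pos_left hm,
    mul_lt_mul_iff_right₀ hm]

lemma setLIntegral_Ico_add {F : ℝ → ℝ≥0∞} {h s : ℝ} (hh : 0 ≤ h) (hs : 0 ≤ s) :
    ∫⁻ u in Set.Ico 0 (h + s), F u =
      (∫⁻ u in Set.Ico 0 h, F u) + ∫⁻ u in Set.Ico 0 s, F (u + h) := by
  have hdisj : Disjoint (Set.Ico 0 h) (Set.Ico h (h + s)) := Set.Ico_disjoint_Ico_same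
  rw [← Set.Ico_union_Ico_eq_Ico hh (le_add_of_nonneg_right hs),
    lintegral_union measurableSet_Ico hdisj]
  congr 1
  rw [← lintegral_indicator measurableSet_Ico, ← lintegral_indicator measurableSet_Ico,
    ← lintegral_add_right_eq_self ((Set.Ico h (h + s)).indicator F) h]
  refine lintegral_congr fun u => ?_
  simp [Set.indicator_apply, add_comm h s]

lemma measurable_envPath : Measurable (envPath : Env Γ × Traj d → ℝ≥0 → Env Γ) :=
  measurable_envProcess

lemma measurable_timeShift_toNNReal_envPath :
    Measurable fun p : (Env Γ × Traj d) × ℝ => timeShift p.2.toNNReal (envPath p.1) := by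
  have h : Measurable fun p : (Env Γ × Traj d) × ℝ => (p.1, p.2.toNNReal) := by fun_prop
  have h2 := measurable_timeShift_envPath.fun_comp h
  simp only at h2
  exact h2

/-! ### Sojourn representation of the path law and its stationarity -/

section FixedTime

variable {P : Measure (Env Γ)} [IsProbabilityMeasure P]

/-- The integral of a path functional over the time up to the first jump. -/
def firstSojourn (f : (ℝ≥0 → Env Γ) → ℝ≥0∞) (q : Env Γ × Traj d) : ℝ≥0∞ :=
  ∫⁻ u in Set.Ico 0 (holdingTime q.1 q.2 0).toReal, f (timeShift u.toNNReal (envPath q))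

lemma measurable_firstSojourn {f : (ℝ≥0 → Env Γ) → ℝ≥0∞} (hf : Measurable f) :
    Measurable (firstSojourn f) := by
  have hH := hf.fun_comp (measurable_timeShift_toNNReal_envPath (Γ := Γ))
  have : ∀ q : Env Γ × Traj d, firstSojourn f q =
      ∫⁻ u, {p : (Env Γ × Traj d) × ℝ |
          0 ≤ p.2 ∧ p.2 < (holdingTime p.1.1 p.1.2 0).toReal}.indicator
        (fun p => f (timeShift p.2.toNNReal (envPath p.1))) (q, u) := by
    intro q
    rw [firstSojourn, ← lintegral_indicator measurableSet_Ico]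
    rfl
  rw [funext this]
  refine Measurable.lintegral_prod_right' (hH.indicator ?_)
  exact (measurableSet_le measurable_const measurable_snd).inter
    (measurableSet_lt measurable_snd (measurable_holdingTime_zero.comp measurable_fst).ennreal_toReal)

/-- Observing the path from time `u` on equals lowering the first clock by `v = μ^ω(0) u`. The
density of the jump-chain measure is exactly the Jacobian of this substitution. -/
lemma IsRegularPath.muWeight_mul_firstSojourn {f : (ℝ≥0 → Env Γ) → ℝ≥0∞} (hf : Measurable f)
    {ω : Env Γ} {ξ : Traj d} (hq : IsRegularPath (ω, ξ)) :
    muWeight ω 0 * firstSojourn f (ω, ξ) =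
      ∫⁻ v in Set.Icc 0 (ξ.2 0), f (envPath (ω, advance v ξ)) := by
  have hω : IsRegular ω := hq.regular
  have hm0 : 0 < (muWeight ω 0).toReal :=
    ENNReal.toReal_pos (hω.muWeight_ne_zero 0) (hω.muWeight_ne_top 0)
  have hadv : Measurable fun v : ℝ => (ω, advance v ξ) :=
    measurable_prodMk_left.comp (measurable_advance.comp measurable_prodMk_left)
  have hfv : Measurable fun v : ℝ => f (envPath (ω, advance v ξ)) :=
    (hf.comp measurable_envPath).comp hadv
  have he : ξ.2 0 = (muWeight ω 0).toReal * (holdingTime ω ξ 0).toReal := by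
    have h1 : ξ.1 0 = 0 := hq.start
    rw [holdingTime, h1, ENNReal.toReal_div, mul_div_cancel₀ _ hm0.ne',
      ENNReal.toReal_ofReal (hq.clock_pos 0).le]
  rw [setLIntegral_congr Ico_ae_eq_Icc.symm, he, setLIntegral_Ico_comp_mul hm0 hfv,
    ENNReal.ofReal_toReal (hω.muWeight_ne_top 0), firstSojourn]
  refine congrArg (muWeight ω 0 * ·) (setLIntegral_congr_fun measurableSet_Ico fun u hu => ?_)
  have hu' : (u.toNNReal : ℝ≥0∞) < holdingTime ω ξ 0 :=
    (ENNReal.ofReal_lt_iff_lt_toReal hu.1 (hq.holdingTime_ne_top 0)).2 hu.2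
  have := hq.envPath_advance hu'
  rw [Real.coe_toNNReal _ hu.1] at this
  exact congrArg f this.symm

lemma lintegral_annealedLaw_advance {G : Env Γ × Traj d → ℝ≥0∞} (hG : Measurable G) :
    ∫⁻ q, G q ∂annealedLaw P = ∫⁻ ω, ∫⁻ ξ,
      (∫⁻ v in Set.Icc 0 (ξ.2 0), G (ω, advance v ξ)) ∂quenchedLaw Γ (ω, 0) ∂P := by
  rw [lintegral_annealedLaw hG]
  exact lintegral_congr fun ω =>
    (lintegral_quenchedLaw_advance (ω, 0) (hG.fun_comp measurable_prodMk_left)).symm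

lemma lintegral_palmLaw_mul {R : Env Γ × Traj d → ℝ≥0∞} (hR : Measurable R) :
    ∫⁻ q, R q ∂palmLaw P =
      ∫⁻ ω, ∫⁻ ξ, muWeight ω 0 * R (ω, ξ) ∂quenchedLaw Γ (ω, 0) ∂P := by
  rw [lintegral_palmLaw hR]
  exact lintegral_congr fun ω =>
    (lintegral_const_mul _ (hR.fun_comp measurable_prodMk_left)).symm

lemma ae_ae_isRegularPath (hP : IsShiftErgodic P) (hreg : ∀ᵐ ω ∂P, IsRegular ω)
    (hmu : ∫⁻ ω, muWeight ω 0 ∂P < ∞) :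
    ∀ᵐ ω ∂P, ∀ᵐ ξ ∂quenchedLaw Γ (ω, 0), IsRegularPath (ω, ξ) := by
  have h := ae_annealedLaw_isRegularPath hP hreg hmu
  unfold annealedLaw at h
  have h2 := Measure.ae_ae_of_ae_compProd h
  simp only [Kernel.comap_apply] at h2
  exact h2

/-- The law of the environment process started from `P` in terms of its jump chain started from the
invariant law. -/
lemma lintegral_annealedLaw_envPath (hP : IsShiftErgodic P) (hreg : ∀ᵐ ω ∂P, IsRegular ω)
    (hmu : ∫⁻ ω, muWeight ω 0 ∂P < ∞) {f : (ℝ≥0 → Env Γ) → ℝ≥0∞} (hf : Measurable f) :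
    ∫⁻ q, f (envPath q) ∂annealedLaw P = ∫⁻ q, firstSojourn f q ∂palmLaw P := by
  rw [lintegral_annealedLaw_advance (hf.fun_comp measurable_envPath),
    lintegral_palmLaw_mul (measurable_firstSojourn hf)]
  refine lintegral_congr_ae ((ae_ae_isRegularPath hP hreg hmu).mono fun ω hω => ?_)
  exact lintegral_congr_ae (hω.mono fun ξ hξ => (hξ.muWeight_mul_firstSojourn hf).symm)

/-- Along a regular trajectory the sojourn integrals telescope under restarting. -/
lemma IsRegularPath.firstSojourn_timeShift {q : Env Γ × Traj d} (hq : IsRegularPath q)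
    (f : (ℝ≥0 → Env Γ) → ℝ≥0∞) (s : ℝ≥0) :
    firstSojourn (fun p => f (timeShift s p)) q +
        ∫⁻ u in Set.Ico (0 : ℝ) s, f (timeShift u.toNNReal (envPath q)) =
      firstSojourn f q +
        ∫⁻ u in Set.Ico (0 : ℝ) s, f (timeShift u.toNNReal (envPath (restart 1 q))) := by
  unfold firstSojourn
  set h := (holdingTime q.1 q.2 0).toReal with hdef
  have hh : 0 ≤ h := ENNReal.toReal_nonneg
  let F : ℝ → ℝ≥0∞ := fun u => f (timeShift u.toNNReal (envPath q))
  have h1 : ∫⁻ u in Set.Ico 0 h, f (timeShift s (timeShift u.toNNReal (envPath q))) =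
      ∫⁻ u in Set.Ico 0 h, F (u + s) := by
    refine setLIntegral_congr_fun measurableSet_Ico fun u hu => ?_
    have hus : (u + s).toNNReal = u.toNNReal + s := by
      rw [Real.toNNReal_add hu.1 s.coe_nonneg, Real.toNNReal_coe]
    simp only [F, timeShift_timeShift, hus]
  have h2 : ∫⁻ u in Set.Ico (0 : ℝ) s, f (timeShift u.toNNReal (envPath (restart 1 q))) =
      ∫⁻ u in Set.Ico (0 : ℝ) s, F (u + h) := by
    refine setLIntegral_congr_fun measurableSet_Ico fun u hu => ?_
    have hh' : h.toNNReal = (holdingTime q.1 q.2 0).toNNReal := ENNReal.toNNReal_toReal_eq _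
    simp only [F, hq.envPath_restart, timeShift_timeShift, Real.toNNReal_add hu.1 hh, hh', add_comm]
  -- Both sides are the integral of `F` over `[0, h + s)`, cut once at `h` and once at `s`.
  have h3 := setLIntegral_Ico_add (F := F) hh s.2
  have h4 := setLIntegral_Ico_add (F := F) s.2 hh
  rw [add_comm] at h4
  rw [h1, h2]
  exact (add_comm _ _).trans (h4.symm.trans h3)

/-- The law of the environment process started from `P` does not change under time shifts. -/
lemma map_timeShift_envPathLaw (hP : IsShiftErgodic P) (hreg : ∀ᵐ ω ∂P, IsRegular ω)
    (hmu : ∫⁻ ω, muWeight ω 0 ∂P < ∞) (s : ℝ≥0) :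
    (envPathLaw P).map (timeShift s) = envPathLaw P := by
  have := isFiniteMeasure_palmLaw hmu
  have hlaw : ∀ {f : (ℝ≥0 → Env Γ) → ℝ≥0∞}, Measurable f →
      ∫⁻ p, f p ∂envPathLaw P = ∫⁻ q, f (envPath q) ∂annealedLaw P := fun hf =>
    lintegral_map hf measurable_envPath
  ext B hB
  obtain ⟨f, hfB⟩ : ∃ f : (ℝ≥0 → Env Γ) → ℝ≥0∞, f = B.indicator 1 := ⟨_, rfl⟩
  have hf : Measurable f := hfB ▸ measurable_one.indicator hB
  have hf1 : ∀ p, f p ≤ 1 := fun p => hfB ▸ Set.indicator_le_self' (fun _ _ => zero_le) p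
  have hfs : Measurable fun p => f (timeShift s p) := hf.comp (measurable_timeShift s)
  rw [← lintegral_indicator_one hB, ← lintegral_indicator_one hB, ← hfB,
    lintegral_map hf (measurable_timeShift s), hlaw hfs, hlaw hf,
    lintegral_annealedLaw_envPath hP hreg hmu hfs, lintegral_annealedLaw_envPath hP hreg hmu hf]
  -- The boundary term of the telescoping identity. It is bounded by `s`, so its integral is finite
  -- and may be cancelled.
  obtain ⟨C, hCdef⟩ : ∃ C : Env Γ × Traj d → ℝ≥0∞, C = fun q =>
    ∫⁻ u in Set.Ico (0 : ℝ) s, f (timeShift u.toNNReal (envPath q)) := ⟨_, rfl⟩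
  have hC : Measurable C := hCdef ▸ (hf.fun_comp
    measurable_timeShift_toNNReal_envPath).lintegral_prod_right'
  have hC1 : ∀ q, C q ≤ s := fun q => by
    rw [hCdef]
    exact (lintegral_mono fun u => hf1 _).trans_eq (by simp)
  have hfin : ∫⁻ q, C q ∂palmLaw P ≠ ∞ := by
    refine ((lintegral_mono hC1).trans_lt ?_).ne
    rw [lintegral_const]
    exact ENNReal.mul_lt_top ENNReal.coe_lt_top (measure_lt_top _ _)
  have hinv := (measurePreserving_restart_one hP hreg).lintegral_comp hC
  refine (ENNReal.add_left_inj hfin).1 ?_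
  rw [← lintegral_add_right _ hC]
  -- On the right the added integral is rewritten with `C ∘ restart 1`, so the two integrands agree
  -- along regular paths.
  conv_rhs => rw [← hinv, ← lintegral_add_right _ (hC.fun_comp (measurable_restart 1))]
  refine lintegral_congr_ae ?_
  filter_upwards [palmLaw_absolutelyContinuous.ae_le (ae_annealedLaw_isRegularPath hP hreg hmu)]
    with q hq
  rw [hCdef]
  exact hq.firstSojourn_timeShift f s

/-- The first clock is positive, so at time zero the walk is still at the origin. -/
lemma map_eval_zero_envPathLaw (hP : IsShiftErgodic P) (hreg : ∀ᵐ ω ∂P, IsRegular ω)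
    (hmu : ∫⁻ ω, muWeight ω 0 ∂P < ∞) : (envPathLaw P).map (fun p => p 0) = P := by
  rw [envPathLaw, Measure.map_map (measurable_pi_apply 0) measurable_envProcess]
  have h : (annealedLaw P).map Prod.fst = P := Measure.fst_compProd _ _
  conv_rhs => rw [← h]
  refine Measure.map_congr ?_
  filter_upwards [ae_annealedLaw_isRegularPath hP hreg hmu] with q hq
  have hpos : 0 < jumpTime q.1 q.2 1 := by
    simp only [jumpTime, Finset.sum_range_one, holdingTime]
    exact ENNReal.div_pos (ENNReal.ofReal_pos.2 (hq.clock_pos 0)).ne'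
      (hq.regular.muWeight_ne_top _)
  have hw : walk q.1 q.2 0 = q.2.1 0 := walk_eq (by simp [jumpTime]) (by simpa using hpos)
  simp [envProcess, hw, hq.start]

lemma envTransition_lintegral (t : ℝ≥0) {A : Set (Env Γ)} (hA : MeasurableSet A) :
    ∫⁻ ω, envTransition t ω A ∂P = envPathLaw P {p | p t ∈ A} := by
  have hs : MeasurableSet {p : ℝ≥0 → Env Γ | p t ∈ A} := measurable_pi_apply t hA
  rw [envPathLaw, Measure.map_apply measurable_envProcess hs, annealedLaw,
    Measure.compProd_apply (measurable_envProcess hs)]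
  rfl

lemma isStationaryForEnvProcess (hP : IsShiftErgodic P) (hreg : ∀ᵐ ω ∂P, IsRegular ω)
    (hmu : ∫⁻ ω, muWeight ω 0 ∂P < ∞) : IsStationaryForEnvProcess P where
  invariant t A hA := by
    rw [envTransition_lintegral t hA]
    have h0 : MeasurableSet {p : ℝ≥0 → Env Γ | p 0 ∈ A} := measurable_pi_apply 0 hA
    have hpre : {p : ℝ≥0 → Env Γ | p t ∈ A} = timeShift t ⁻¹' {p | p 0 ∈ A} := by
      ext p; simp [timeShift]
    rw [hpre, ← Measure.map_apply (measurable_timeShift t) h0,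
      map_timeShift_envPathLaw hP hreg hmu t]
    conv_rhs => rw [← map_eval_zero_envPathLaw hP hreg hmu,
      Measure.map_apply (measurable_pi_apply 0) hA]
    rfl
  map_timeShift s := map_timeShift_envPathLaw hP hreg hmu s

end FixedTime

/-! ### Ergodicity -/

lemma expMeasure_Iic_pos {m : ℝ} (hm : 0 < m) : expMeasure 1 (Set.Iic m) ≠ 0 := by
  rw [← ofReal_cdf, cdf_expMeasure_eq one_pos, if_pos hm.le]
  refine (ENNReal.ofReal_pos.2 (sub_pos.2 ?_)).ne'
  rw [Real.exp_lt_one_iff]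
  linarith

lemma expMeasure_Ioi_pos {m : ℝ} (hm : 0 ≤ m) : expMeasure 1 (Set.Ioi m) ≠ 0 := by
  rw [← Set.compl_Iic, prob_compl_eq_one_sub measurableSet_Iic, ← ofReal_cdf,
    cdf_expMeasure_eq one_pos, if_pos hm]
  refine (tsub_pos_of_lt ?_).ne'
  rw [ENNReal.ofReal_lt_one]
  have := Real.exp_pos (-(1 * m))
  linarith

/-- The walk can be at any out-neighbour of the origin at the time one. -/
lemma IsRegular.quenchedLaw_walk_one_ne_zero {ω : Env Γ} (hω : IsRegular ω) {z : Vertex d}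
    (hz : edgeWeight ω 0 z ≠ 0) : quenchedLaw Γ (ω, 0) {ξ | walk ω ξ 1 = z} ≠ 0 := by
  classical
  let y : ℕ → Vertex d := fun i => if i = 0 then 0 else z
  let m : Vertex d → ℝ := fun x => (muWeight ω x).toReal
  have hm : ∀ x, 0 < m x := fun x =>
    ENNReal.toReal_pos (hω.muWeight_ne_zero x) (hω.muWeight_ne_top x)
  -- These clock ranges make the first holding time at most `1` and the second more than `1`, so
  -- exactly one jump, to `z`, occurs by time one.
  let t : ℕ → Set ℝ := fun i => if i = 0 then Set.Iic (m 0) else Set.Ioi (m z)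
  have ht : ∀ i, MeasurableSet (t i) := fun i => by
    simp only [t]
    split_ifs
    exacts [measurableSet_Iic, measurableSet_Ioi]
  have hsub : prefixSet 1 y ×ˢ Set.pi (Finset.range 2 : Finset ℕ) t ⊆
      {ξ : Traj d | walk ω ξ 1 = z} := by
    rintro ξ ⟨h1, h2⟩
    have hY0 : ξ.1 0 = 0 := h1 0 (by simp)
    have hY1 : ξ.1 1 = z := h1 1 le_rfl
    have he0 : ξ.2 0 ≤ m 0 := h2 0 (by simp)
    have he1 : m z < ξ.2 1 := h2 1 (by simp)
    have hh0 : holdingTime ω ξ 0 ≤ 1 := by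
      rw [holdingTime, hY0]
      refine ENNReal.div_le_of_le_mul ?_
      rw [one_mul]
      exact ENNReal.ofReal_le_of_le_toReal he0
    have hh1 : 1 < holdingTime ω ξ 1 := by
      rw [holdingTime, hY1, ENNReal.lt_div_iff_mul_lt (Or.inl (hω.muWeight_ne_zero z))
        (Or.inl (hω.muWeight_ne_top z)), one_mul]
      exact (ENNReal.lt_ofReal_iff_toReal_lt (hω.muWeight_ne_top z)).2 he1
    rw [Set.mem_ofPred_eq, ← hY1]
    refine walk_eq ?_ ?_
    · simpa [jumpTime] using hh0
    · rw [jumpTime, Finset.sum_range_succ]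
      exact (by exact_mod_cast hh1 : ((1 : ℝ≥0) : ℝ≥0∞) < _).trans_le le_add_self
  refine fun h0 => ?_
  have hzero := measure_mono_null hsub h0
  rw [quenchedLaw_apply, Measure.prod_prod, Measure.infinitePi_pi _ (fun i _ => ht i),
    chainKernel_prefixSet, mul_eq_zero] at hzero
  rcases hzero with h | h
  · simp only [y, if_true, one_mul, Finset.prod_range_one, zero_add, one_ne_zero, if_false,
      hω.jumpMeasure_singleton] at h
    exact (ENNReal.div_pos hz (hω.muWeight_ne_top 0)).ne' h
  · rw [Finset.prod_range_succ, Finset.prod_range_one, mul_eq_zero] at h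
    rcases h with h | h
    · exact expMeasure_Iic_pos (hm 0) (by simpa [t] using h)
    · exact expMeasure_Ioi_pos (hm z).le (by simpa [t] using h)

section Ergodicity

variable {P : Measure (Env Γ)}

lemma measurableSet_envProcess_mem (t : ℝ≥0) (ω : Env Γ) {A : Set (Env Γ)}
    (hA : MeasurableSet A) : MeasurableSet {ξ : Traj d | envProcess ω ξ t ∈ A} :=
  measurable_prodMk_left (x := ω)
    (((measurable_pi_apply t).comp measurable_envProcess) hA : MeasurableSet
      {q : Env Γ × Traj d | envProcess q.1 q.2 t ∈ A})

/-- Each out-neighbour is occupied at time one with positive probability, so a transition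
probability of zero or one forces membership in `A` to agree across every usable edge. -/
lemma zero_or_one_of_invariant (hP : IsShiftErgodic P) (hreg : ∀ᵐ ω ∂P, IsRegular ω)
    {A : Set (Env Γ)} (hA : MeasurableSet A)
    (h : ∀ᵐ ω ∂P, envTransition 1 ω A = A.indicator 1 ω) : P A = 0 ∨ P A = 1 := by
  refine hP.zero_or_one_of_jump hreg hA ?_
  filter_upwards [h, hreg] with ω h1 hω z hz
  have hpos := hω.quenchedLaw_walk_one_ne_zero hz
  have hms := measurableSet_envProcess_mem 1 ω hA
  constructor
  · intro hzA
    by_contra hωA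
    rw [Set.indicator_of_notMem hωA] at h1
    refine hpos (measure_mono_null (fun ξ hξ => ?_) h1)
    have hξ' : walk ω ξ 1 = z := hξ
    simpa [envProcess, hξ'] using hzA
  · intro hωA
    by_contra hzA
    rw [Set.indicator_of_mem hωA] at h1
    refine hpos (measure_mono_null (fun ξ hξ => ?_) ((prob_compl_eq_zero_iff hms).2 h1))
    have hξ' : walk ω ξ 1 = z := hξ
    simpa [envProcess, hξ'] using hzA

/-! ### Zero-one law for path events -/

variable [IsProbabilityMeasure P]

/-- The quenched probability of an event, as a function of the environment. -/
def quenchedProb (D : Set (Env Γ × Traj d)) (ω : Env Γ) : ℝ≥0∞ :=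
  quenchedLaw Γ (ω, 0) {ξ | (ω, ξ) ∈ D}

lemma quenchedProb_eq_lintegral {D : Set (Env Γ × Traj d)} (hD : MeasurableSet D) (ω : Env Γ) :
    quenchedProb D ω = ∫⁻ ξ, D.indicator 1 (ω, ξ) ∂quenchedLaw Γ (ω, 0) := by
  have h : MeasurableSet {ξ : Traj d | (ω, ξ) ∈ D} := measurable_prodMk_left hD
  rw [quenchedProb, ← lintegral_indicator_one h]
  rfl

lemma measurable_quenchedProb {D : Set (Env Γ × Traj d)} (hD : MeasurableSet D) :
    Measurable (quenchedProb D) := by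
  rw [funext (quenchedProb_eq_lintegral hD)]
  exact measurable_lintegral_quenchedLaw (measurable_one.indicator hD)

lemma quenchedProb_add_compl {D : Set (Env Γ × Traj d)} (hD : MeasurableSet D) (ω : Env Γ) :
    quenchedProb D ω + quenchedProb Dᶜ ω = 1 := by
  have h : MeasurableSet {ξ : Traj d | (ω, ξ) ∈ D} := measurable_prodMk_left hD
  exact prob_add_prob_compl h

/-- A set of trajectories that depends on the jump chain and the clocks before the `n`-th jump only. -/
def DependsOnPrefix (n : ℕ) (C : Set (Env Γ × Traj d)) : Prop :=
  ∀ ω ξ ξ', (ω, Traj.glue n ξ ξ') ∈ C ↔ (ω, ξ) ∈ C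

lemma DependsOnPrefix.mono {m n : ℕ} (hmn : n ≤ m) {C : Set (Env Γ × Traj d)}
    (hC : DependsOnPrefix n C) : DependsOnPrefix m C := by
  intro ω ξ ξ'
  have h : ∀ {α : Type} (a b : ℕ → α), glue n (glue m a b) a = glue n a a := by
    intro α a b
    ext i
    by_cases hi : i < n
    · rw [glue_of_lt hi, glue_of_lt hi, glue_of_lt (hi.trans_le hmn)]
    · simp [glue, hi]
  -- Changes made from index `m` on are overwritten by gluing at the smaller index `n`.
  have h' : Traj.glue n (Traj.glue m ξ ξ') ξ = Traj.glue n ξ ξ := Prod.ext (h _ _) (h _ _)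
  rw [← hC ω (Traj.glue m ξ ξ') ξ, h', hC]

lemma DependsOnPrefix.compl {n : ℕ} {C : Set (Env Γ × Traj d)} (hC : DependsOnPrefix n C) :
    DependsOnPrefix n Cᶜ := fun ω ξ ξ' => not_congr (hC ω ξ ξ')

lemma isSetRing_dependsOnPrefix : IsSetRing
    {C : Set (Env Γ × Traj d) | MeasurableSet C ∧ ∃ n, DependsOnPrefix n C} where
  empty_mem := ⟨MeasurableSet.empty, 0, fun _ _ _ => Iff.rfl⟩
  union_mem := by
    rintro s t ⟨hs, m, hm⟩ ⟨ht, n, hn⟩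
    exact ⟨hs.union ht, max m n, fun ω ξ ξ' => or_congr
      (hm.mono (le_max_left _ _) ω ξ ξ') (hn.mono (le_max_right _ _) ω ξ ξ')⟩
  sdiff_mem := by
    rintro s t ⟨hs, m, hm⟩ ⟨ht, n, hn⟩
    exact ⟨hs.diff ht, max m n, fun ω ξ ξ' => and_congr
      (hm.mono (le_max_left _ _) ω ξ ξ') (not_congr (hn.mono (le_max_right _ _) ω ξ ξ'))⟩

/-- Each position or clock is determined by a finite prefix, and the environment by the empty one.
Prefix events can therefore approximate any event in measure. -/
lemma generateFrom_dependsOnPrefix :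
    (inferInstance : MeasurableSpace (Env Γ × Traj d)) = MeasurableSpace.generateFrom
      {C : Set (Env Γ × Traj d) | MeasurableSet C ∧ ∃ n, DependsOnPrefix n C} := by
  refine le_antisymm ?_ (MeasurableSpace.generateFrom_le fun C hC => hC.1)
  have hY : ∀ i, Measurable fun q : Env Γ × Traj d => q.2.1 i := fun i => by fun_prop
  have he : ∀ i, Measurable fun q : Env Γ × Traj d => q.2.2 i := fun i => by fun_prop
  set G := MeasurableSpace.generateFrom
    {C : Set (Env Γ × Traj d) | MeasurableSet C ∧ ∃ n, DependsOnPrefix n C}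
  have h1 : @Measurable _ _ G _ (fun q : Env Γ × Traj d => q.1) := fun s hs =>
    MeasurableSpace.measurableSet_generateFrom ⟨measurable_fst hs, 0, fun _ _ _ => Iff.rfl⟩
  have h2 : @Measurable _ _ G _ (fun q : Env Γ × Traj d => q.2.1) := by
    refine @measurable_pi_lambda _ _ _ G _ _ fun i s hs => ?_
    refine MeasurableSpace.measurableSet_generateFrom ⟨?_, i + 1, fun ω ξ ξ' => ?_⟩
    · exact hY i hs
    · simp [Traj.glue, glue_of_lt (Nat.lt_succ_self i)]
  have h3 : @Measurable _ _ G _ (fun q : Env Γ × Traj d => q.2.2) := by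
    refine @measurable_pi_lambda _ _ _ G _ _ fun i s hs => ?_
    refine MeasurableSpace.measurableSet_generateFrom ⟨?_, i + 1, fun ω ξ ξ' => ?_⟩
    · exact he i hs
    · simp [Traj.glue, glue_of_lt (Nat.lt_succ_self i)]
  exact fun s hs => (h1.prodMk (h2.prodMk h3)) hs

/-- The Markov property of the restarted walk under the invariant law of the jump chain. -/
lemma palmLaw_inter_restart {n : ℕ} {C D : Set (Env Γ × Traj d)} (hC : MeasurableSet C)
    (hCn : DependsOnPrefix n C) (hD : MeasurableSet D) :
    palmLaw P (C ∩ restart n ⁻¹' D) =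
      ∫⁻ q, C.indicator 1 q * quenchedProb D (restart n q).1 ∂palmLaw P := by
  have h1 : Measurable (C.indicator (1 : Env Γ × Traj d → ℝ≥0∞)) := measurable_one.indicator hC
  have h2 : Measurable (D.indicator (1 : Env Γ × Traj d → ℝ≥0∞)) := measurable_one.indicator hD
  have h3 : Measurable fun q : Env Γ × Traj d => quenchedProb D (restart n q).1 :=
    (measurable_quenchedProb hD).fun_comp (measurable_fst.fun_comp (measurable_restart n))
  have hL : ∀ q, (C ∩ restart n ⁻¹' D).indicator (1 : Env Γ × Traj d → ℝ≥0∞) q =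
      C.indicator 1 q * D.indicator 1 (restart n q) := by
    intro q
    by_cases hq : q ∈ C <;> by_cases hq' : restart n q ∈ D <;> simp [hq, hq']
  rw [← lintegral_indicator_one (hC.inter (measurable_restart n hD)), lintegral_congr hL,
    lintegral_palmLaw (h1.fun_mul (h2.fun_comp (measurable_restart n))),
    lintegral_palmLaw (h1.fun_mul h3)]
  refine lintegral_congr fun ω => congrArg (muWeight ω 0 * ·) ?_
  have key := lintegral_quenchedLaw_restart ω 0 n (f := fun ξ => C.indicator 1 (ω, ξ))
    (h1.fun_comp measurable_prodMk_left) (fun ξ ξ' => by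
      classical simp only [Set.indicator_apply, hCn ω ξ ξ', Pi.one_apply]) h2
  rw [key]
  refine lintegral_congr fun ξ => congrArg (C.indicator 1 (ω, ξ) * ·) ?_
  exact (quenchedProb_eq_lintegral hD _).symm

/-- An event that is invariant under restarting the walk at its first jump has quenched probability
zero or one. -/
lemma quenchedProb_zero_or_one (hP : IsShiftErgodic P) (hreg : ∀ᵐ ω ∂P, IsRegular ω)
    (hmu : ∫⁻ ω, muWeight ω 0 ∂P < ∞) {D : Set (Env Γ × Traj d)} (hD : MeasurableSet D)
    (hinv : ∀ n, restart n ⁻¹' D =ᵐ[palmLaw P] D) :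
    ∀ᵐ ω ∂P, quenchedProb D ω = 0 ∨ quenchedProb Dᶜ ω = 0 := by
  have := isFiniteMeasure_palmLaw hmu
  -- With `φ = quenchedProb D`, this is `φ (1 - φ)`; its integral is shown to be smaller than any
  -- `ε`.
  let g : Env Γ → ℝ≥0∞ := fun ω => quenchedProb D ω * quenchedProb Dᶜ ω
  have hφ := measurable_quenchedProb hD
  have hψ := measurable_quenchedProb hD.compl
  have hg : Measurable g := hφ.mul hψ
  have hφ1 : ∀ ω, quenchedProb D ω ≤ 1 := fun ω => prob_le_one
  have hψ1 : ∀ ω, quenchedProb Dᶜ ω ≤ 1 := fun ω => prob_le_one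
  have hgq : Measurable fun q : Env Γ × Traj d => g q.1 := hg.comp measurable_fst
  have hbound : ∀ ε : ℝ≥0∞, 0 < ε → ∫⁻ q, g q.1 ∂palmLaw P ≤ ε := by
    intro ε hε
    obtain ⟨C, ⟨hC, n, hn⟩, hCD⟩ := exists_measure_symmDiff_lt_of_generateFrom_isSetRing
      (μ := palmLaw P) isSetRing_dependsOnPrefix
      ⟨{Set.univ}, by simp, by simpa using ⟨0, fun _ _ _ => Iff.rfl⟩, by simp⟩
      generateFrom_dependsOnPrefix hD hε
    have hcomp : ∀ n, restart n ⁻¹' Dᶜ =ᵐ[palmLaw P] (Dᶜ : Set _) := fun n => (hinv n).compl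
    have hmeas : ∀ {E : Set (Env Γ × Traj d)}, MeasurableSet E → Measurable fun q =>
        quenchedProb E (restart n q).1 := fun hE =>
      (measurable_quenchedProb hE).fun_comp (measurable_fst.fun_comp (measurable_restart n))
    calc ∫⁻ q, g q.1 ∂palmLaw P
        = ∫⁻ q, g (restart n q).1 ∂palmLaw P :=
          ((measurePreserving_restart hP hreg n).lintegral_comp hgq).symm
      -- `g` is at most either of its factors; the factor kept is the probability of error if `C` is
      -- used to predict `D`.
      _ ≤ ∫⁻ q, (C.indicator 1 q * quenchedProb Dᶜ (restart n q).1 +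
            Cᶜ.indicator 1 q * quenchedProb D (restart n q).1) ∂palmLaw P := by
          refine lintegral_mono fun q => ?_
          by_cases hq : q ∈ C
          · simpa [hq, g] using mul_le_of_le_one_left' (hφ1 _)
          · simpa [hq, g] using mul_le_of_le_one_right' (hψ1 _)
      _ = palmLaw P (C ∩ restart n ⁻¹' Dᶜ) + palmLaw P (Cᶜ ∩ restart n ⁻¹' D) := by
          rw [lintegral_add_left ((measurable_one.indicator hC).fun_mul (hmeas hD.compl)),
            palmLaw_inter_restart hC hn hD.compl, palmLaw_inter_restart hC.compl hn.compl hD]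
      -- Invariance of `D` under `restart n` turns the future event back into `D`, leaving only the
      -- approximation error.
      _ = palmLaw P (C ∩ Dᶜ) + palmLaw P (Cᶜ ∩ D) := by
          exact congrArg₂ (· + ·) (measure_congr ((ae_eq_refl C).inter (hcomp n)))
            (measure_congr ((ae_eq_refl Cᶜ).inter (hinv n)))
      _ = palmLaw P (symmDiff C D) := by
          rw [Set.symmDiff_def, measure_union _ (hD.diff hC), Set.sdiff_eq, Set.sdiff_eq,
            Set.inter_comm Cᶜ]
          exact disjoint_sdiff_sdiff
      _ ≤ ε := hCD.le
  have hzero : ∫⁻ q, g q.1 ∂palmLaw P = 0 :=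
    le_antisymm (le_of_forall_gt_imp_ge_of_dense fun ε hε => hbound ε hε) zero_le
  rw [lintegral_eq_zero_iff hgq] at hzero
  have h1 : ∀ᵐ q ∂annealedLaw P, g q.1 = 0 := (annealedLaw_absolutelyContinuous hreg).ae_le hzero
  have hfst : (annealedLaw P).map Prod.fst = P := Measure.fst_compProd _ _
  rw [← hfst, ae_map_iff measurable_fst.aemeasurable]
  · exact h1.mono fun q hq => mul_eq_zero.1 hq
  · exact (hφ (measurableSet_singleton 0)).union (hψ (measurableSet_singleton 0))

/-- Invariance under restarting and the Markov property at the first jump make the quenched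
probability its own average over the next position. -/
lemma quenchedProb_harmonic {D : Set (Env Γ × Traj d)} (hD : MeasurableSet D)
    (hreg : ∀ᵐ ω ∂P, IsRegular ω) (hinv : restart 1 ⁻¹' D =ᵐ[palmLaw P] D) :
    ∀ᵐ ω ∂P, quenchedProb D ω = ∫⁻ y, quenchedProb D (shift y ω) ∂jumpMeasure ω 0 := by
  have h1 : ∀ᵐ q ∂annealedLaw P, (q ∈ restart 1 ⁻¹' D ↔ q ∈ D) :=
    (annealedLaw_absolutelyContinuous hreg).ae_le hinv.mem_iff
  have hms : MeasurableSet {q : Env Γ × Traj d | q ∈ restart 1 ⁻¹' D ↔ q ∈ D} :=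
    MeasurableSet.iff (measurable_restart 1 hD) hD
  filter_upwards [(ae_annealedLaw_iff hms).1 h1] with ω hω
  have h2 : Measurable (D.indicator (1 : Env Γ × Traj d → ℝ≥0∞)) := measurable_one.indicator hD
  have key := lintegral_quenchedLaw_restart ω 0 1 measurable_one (fun _ _ => rfl) h2
  simp only [Pi.one_apply, one_mul] at key
  rw [quenchedProb_eq_lintegral hD, ← lintegral_quenchedLaw_one ω 0]
  refine Eq.trans ?_ (key.trans (lintegral_congr fun ξ => (quenchedProb_eq_lintegral hD _).symm))
  refine lintegral_congr_ae (hω.mono fun ξ hξ => ?_)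
  have hξ' : restart 1 (ω, ξ) ∈ D ↔ (ω, ξ) ∈ D := hξ
  classical simp only [Set.indicator_apply, hξ', Pi.one_apply]

/-- A nonnegative harmonic function that vanishes at a point vanishes at all out-neighbours. Applied
to `D` and to `Dᶜ`, this carries both values zero and one across usable edges. -/
lemma zero_or_one_of_restart_invariant (hP : IsShiftErgodic P) (hreg : ∀ᵐ ω ∂P, IsRegular ω)
    (hmu : ∫⁻ ω, muWeight ω 0 ∂P < ∞) {D : Set (Env Γ × Traj d)} (hD : MeasurableSet D)
    (hinv : ∀ n, restart n ⁻¹' D =ᵐ[palmLaw P] D) :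
    annealedLaw P D = 0 ∨ annealedLaw P D = 1 := by
  let A : Set (Env Γ) := {ω | quenchedProb Dᶜ ω = 0}
  have hA : MeasurableSet A := measurable_quenchedProb hD.compl (measurableSet_singleton 0)
  have hzo := quenchedProb_zero_or_one hP hreg hmu hD hinv
  have hone : ∀ ω, quenchedProb Dᶜ ω = 0 → quenchedProb D ω = 1 := fun ω h => by
    have := quenchedProb_add_compl hD ω
    rwa [h, add_zero] at this
  have hlaw : annealedLaw P D = P A := by
    have h1 : annealedLaw P D = ∫⁻ ω, quenchedProb D ω ∂P := by
      rw [← lintegral_indicator_one hD, lintegral_annealedLaw (measurable_one.indicator hD)]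
      exact lintegral_congr fun ω => (quenchedProb_eq_lintegral hD ω).symm
    rw [h1, ← lintegral_indicator_one hA]
    refine lintegral_congr_ae (hzo.mono fun ω hω => ?_)
    by_cases h : quenchedProb Dᶜ ω = 0
    · rw [hone ω h, Set.indicator_of_mem (show ω ∈ A from h), Pi.one_apply]
    · rw [hω.resolve_right h, Set.indicator_of_notMem (show ω ∉ A from h)]
  rw [hlaw]
  refine hP.zero_or_one_of_jump hreg hA ?_
  have hcinv : restart 1 ⁻¹' Dᶜ =ᵐ[palmLaw P] (Dᶜ : Set _) := (hinv 1).compl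
  filter_upwards [hreg, hzo, hP.ae_forall_shift hzo, quenchedProb_harmonic hD hreg (hinv 1),
    quenchedProb_harmonic hD.compl hreg hcinv] with ω hω h0 hs h1 h2 z hz
  have hjump : jumpMeasure ω 0 {z} ≠ 0 := by
    rw [hω.jumpMeasure_singleton]
    exact (ENNReal.div_pos hz (hω.muWeight_ne_top 0)).ne'
  have hnb : ∀ {E : Set (Env Γ × Traj d)},
      ∫⁻ y, quenchedProb E (shift y ω) ∂jumpMeasure ω 0 = 0 → quenchedProb E (shift z ω) = 0 := by
    intro E hE
    rw [lintegral_countable', ENNReal.tsum_eq_zero] at hE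
    exact (mul_eq_zero.1 (hE z)).resolve_right hjump
  constructor
  · intro hzA
    by_contra hωA
    have := hnb (h1.symm.trans (h0.resolve_right hωA))
    rw [hone _ hzA] at this
    exact one_ne_zero this
  · intro hωA
    exact hnb (h2.symm.trans hωA)

/-- A path event invariant under all time shifts is invariant under restarting. -/
lemma restart_preimage_ae_eq (hP : IsShiftErgodic P) (hreg : ∀ᵐ ω ∂P, IsRegular ω)
    (hmu : ∫⁻ ω, muWeight ω 0 ∂P < ∞) {B : Set (ℝ≥0 → Env Γ)} (hB : MeasurableSet B)
    (hinv : ∀ s : ℝ≥0, timeShift s ⁻¹' B =ᵐ[envPathLaw P] B) (n : ℕ) :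
    restart n ⁻¹' (envPath ⁻¹' B) =ᵐ[palmLaw P] envPath ⁻¹' B := by
  have := isFiniteMeasure_palmLaw hmu
  have hms : MeasurableSet {p : (Env Γ × Traj d) × ℝ |
      timeShift p.2.toNNReal (envPath p.1) ∈ B ↔ envPath p.1 ∈ B} :=
    MeasurableSet.iff (measurable_timeShift_toNNReal_envPath hB)
      (measurable_envPath.fun_comp measurable_fst hB)
  have hs : ∀ u : ℝ, ∀ᵐ q ∂palmLaw P,
      (timeShift u.toNNReal (envPath q) ∈ B ↔ envPath q ∈ B) := fun u =>
    palmLaw_absolutelyContinuous.ae_le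
      (ae_of_ae_map measurable_envPath.aemeasurable (hinv u.toNNReal).mem_iff)
  -- The holding time is random, so invariance at each fixed time does not apply to it directly;
  -- Fubini gives invariance at almost every time along almost every trajectory.
  have hae : ∀ᵐ q ∂palmLaw P, ∀ᵐ u : ℝ,
      (timeShift u.toNNReal (envPath q) ∈ B ↔ envPath q ∈ B) :=
    (Measure.ae_ae_comm hms).2 (ae_of_all _ hs)
  have hstep : ∀ᵐ q ∂palmLaw P, (envPath (restart 1 q) ∈ B ↔ envPath q ∈ B) := by
    filter_upwards [hae, (measurePreserving_restart_one hP hreg).quasiMeasurePreserving.ae hae,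
      palmLaw_absolutelyContinuous.ae_le (ae_annealedLaw_isRegularPath hP hreg hmu)]
      with q h1 h2 hq
    set h := holdingTime q.1 q.2 0
    have h3 : ∀ᵐ u : ℝ, (timeShift (u + h.toReal).toNNReal (envPath q) ∈ B ↔ envPath q ∈ B) :=
      (measurePreserving_add_right volume h.toReal).quasiMeasurePreserving.ae h1
    have hne : (ae (volume.restrict (Set.Ici (0 : ℝ)))).NeBot := by
      rw [ae_neBot]
      simp
    -- The restarted path shifted by `u` is the original path shifted by `u + h`. A `u ≥ 0` good for
    -- both exists, since almost every one is; nonnegativity makes `Real.toNNReal` additive.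
    obtain ⟨u, hu, hu2, hu3⟩ := ((ae_restrict_mem (μ := volume)
      (measurableSet_Ici (a := (0 : ℝ)))).and
      ((ae_restrict_of_ae h2).and (ae_restrict_of_ae h3))).exists
    rw [← hu2, ← hu3, hq.envPath_restart, timeShift_timeShift,
      Real.toNNReal_add hu ENNReal.toReal_nonneg, ENNReal.toNNReal_toReal_eq, add_comm]
  refine eventuallyEq_set.2 ?_
  induction n with
  | zero =>
    filter_upwards [palmLaw_absolutelyContinuous.ae_le ae_annealedLaw_zero] with q hq
    have : restart 0 q = q := by
      have := restart_one_iterate 0 hq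
      simpa using this.symm
    simp [this]
  | succ n ih =>
    filter_upwards [ih, (measurePreserving_restart hP hreg n).quasiMeasurePreserving.ae hstep]
      with q h1 h2
    rw [restart_restart] at h2
    exact h2.trans h1

lemma isErgodicForEnvProcess (hP : IsShiftErgodic P) (hreg : ∀ᵐ ω ∂P, IsRegular ω)
    (hmu : ∫⁻ ω, muWeight ω 0 ∂P < ∞) : IsErgodicForEnvProcess P where
  zero_or_one_of_invariant A hA h := zero_or_one_of_invariant hP hreg hA (h 1)
  zero_or_one_of_timeShift B hB h := by
    have hlaw : envPathLaw P B = annealedLaw P (envPath ⁻¹' B) :=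
      Measure.map_apply measurable_envPath hB
    rw [hlaw]
    exact zero_or_one_of_restart_invariant hP hreg hmu (measurable_envPath hB)
      (restart_preimage_ae_eq hP hreg hmu hB h)

end Ergodicity

end CyclicWalk

end

theorem mainTheorem8 (d : ℕ) (hd : 1 ≤ d) (Γ : Set (CyclicWalk.DirectedCycle d))
    (hΓ : CyclicWalk.CoversNeighbours Γ)
    (P : Measure (CyclicWalk.Env Γ)) [IsProbabilityMeasure P]
    (hergodic : CyclicWalk.IsShiftErgodic P)
    (hdoubly : ∀ᵐ ω ∂P, CyclicWalk.IsDoublyStochastic ω)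
    (hnu : ∀ᵐ ω ∂P, CyclicWalk.nuWeight ω 0 < ∞)
    (hmu : ∫⁻ ω, CyclicWalk.muWeight ω 0 ∂P < ∞) :
    (∀ᵐ ω ∂P, ∀ x : CyclicWalk.Vertex d, ∀ᵐ ξ ∂(CyclicWalk.quenchedLaw Γ (ω, x)),
      CyclicWalk.explosionTime ω ξ = ∞ ∧
      CyclicWalk.HasFinitelyManyJumps (CyclicWalk.walk ω ξ) ∧
      CyclicWalk.HasFinitelyManyJumps (CyclicWalk.envProcess ω ξ)) ∧
    CyclicWalk.IsStationaryForEnvProcess P ∧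
    CyclicWalk.IsErgodicForEnvProcess P := by
  have hreg := CyclicWalk.ae_isRegular hd hergodic hdoubly hnu hmu
  refine ⟨?_, CyclicWalk.isStationaryForEnvProcess hergodic hreg hmu,
    CyclicWalk.isErgodicForEnvProcess hergodic hreg hmu⟩
  filter_upwards [CyclicWalk.ae_explosionTime_eq_top hergodic hreg hmu] with ω hω x
  filter_upwards [hω x] with ξ hξ
  have hwalk := CyclicWalk.hasFinitelyManyJumps_walk hξ
  exact ⟨hξ, hwalk, hwalk.comp fun x => CyclicWalk.shift x ω⟩
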